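/- Let $f:\mathbb{R}\to\mathbb{R}$ be bounded and continuous. For $\epsilon>0$ let $H_\epsilon=-\partial_x^2+x^2+\frac{i}{\epsilon}f(x)$ be the unbounded operator on the complex Hilbert space $L^2(\mathbb{R})$ with domain $\{u\in H^2(\mathbb{R}) : x^2u\in L^2(\mathbb{R})\}$, and let $$\Psi(\epsilon)=\Bigl(\sup_{\lambda\in\mathbb{R}}\bigl\|(H_\epsilon-i\lambda)^{-1}\bigr\|\Bigr)^{-1}.$$ For every $\epsilon>0$ the imaginary axis is contained in the resolvent set of $H_\epsilon$ and $0<\Psi(\epsilon)<\infty$. Moreover, $\Psi(\epsilon)\to\infty$ as $\epsilon\to0^+$ if and only if every level set $\{x\in\mathbb{R}: f(x)=c\}$, $c\in\mathbb{R}$, has empty interior. If some level set of $f$ has nonempty interior, then there is a constant $C$ (depending on $f$) such that $\Psi(\epsilon)\le C$ for all $\epsilon>0$. -/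

import Mathlib

open MeasureTheory Filter Topology
open scoped ENNReal NNReal BoundedContinuousFunction SchwartzMap LineDeriv

noncomputable section

namespace SkewOscillator

/-- The complex Hilbert space `L²(ℝ)`. -/
abbrev L2 : Type := Lp ℂ 2 (volume : Measure ℝ)

/-- The domain `{u ∈ H²(ℝ) ; x² u ∈ L²(ℝ)}` of the harmonic oscillator. -/
def domain : Submodule ℂ L2 where
  carrier := {u | TemperedDistribution.MemSobolev 2 2 (u : 𝓢'(ℝ, ℂ)) ∧
    MemLp (fun x : ℝ => ((x ^ 2 : ℝ) : ℂ) * u x) 2 volume}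
  zero_mem' := by
    refine ⟨?_, ?_⟩
    · rw [← Lp.toTemperedDistributionCLM_apply, map_zero]
      exact TemperedDistribution.memSobolev_fun_zero ℝ ℂ 2 2
    · refine (memLp_congr_ae ?_).mpr (MemLp.zero (ε := ℂ) (p := 2) (μ := (volume : Measure ℝ)))
      filter_upwards [Lp.coeFn_zero ℂ 2 (volume : Measure ℝ)] with x hx
      rw [hx]
      simp
  add_mem' := by
    rintro u v ⟨hu, hu'⟩ ⟨hv, hv'⟩
    refine ⟨?_, ?_⟩
    · rw [← Lp.toTemperedDistributionCLM_apply, map_add]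
      exact hu.add hv
    · refine (memLp_congr_ae ?_).mpr (hu'.add hv')
      filter_upwards [Lp.coeFn_add u v] with x hx
      simp only [Pi.add_apply, hx, mul_add]
  smul_mem' := by
    rintro c u ⟨hu, hu'⟩
    refine ⟨?_, ?_⟩
    · rw [← Lp.toTemperedDistributionCLM_apply, map_smul]
      exact hu.smul c
    · refine (memLp_congr_ae ?_).mpr (hu'.const_mul c)
      filter_upwards [Lp.coeFn_smul c u] with x hx
      simp [hx, mul_left_comm]

theorem toTemperedDistribution_injective {u v : L2}
    (h : (u : 𝓢'(ℝ, ℂ)) = (v : 𝓢'(ℝ, ℂ))) : u = v :=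
  LinearMap.ker_eq_bot.mp
    (Lp.ker_toTemperedDistributionCLM_eq_bot (F := ℂ) (μ := (volume : Measure ℝ)) (p := 2)) h

/-- For `u ∈ H²(ℝ)` the distributional second derivative is an `L²` function. -/
theorem exists_secondDeriv (u : domain) :
    ∃ w : L2, (∂_{(1 : ℝ)} (∂_{(1 : ℝ)} ((u : L2) : 𝓢'(ℝ, ℂ)))) = (w : 𝓢'(ℝ, ℂ)) := by
  have h := (u.2.1.lineDerivOp (m := (1 : ℝ))).lineDerivOp (m := (1 : ℝ))
  have h2 : (2 - 1 - 1 : ℝ) = 0 := by norm_num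
  rw [h2, TemperedDistribution.memSobolev_zero_iff] at h
  exact h

/-- The second derivative `u ↦ u''` (in the sense of distributions), as a map into `L²(ℝ)`. -/
def secondDeriv : domain →ₗ[ℂ] L2 where
  toFun u := (exists_secondDeriv u).choose
  map_add' u v := by
    apply toTemperedDistribution_injective
    rw [← (exists_secondDeriv (u + v)).choose_spec]
    have hs : (((exists_secondDeriv u).choose + (exists_secondDeriv v).choose : L2) : 𝓢'(ℝ, ℂ)) =
        ((exists_secondDeriv u).choose : 𝓢'(ℝ, ℂ)) + ((exists_secondDeriv v).choose : 𝓢'(ℝ, ℂ)) :=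
      map_add (Lp.toTemperedDistributionCLM ℂ (volume : Measure ℝ) 2) _ _
    have hd : (((u + v : domain) : L2) : 𝓢'(ℝ, ℂ)) = ((u : L2) : 𝓢'(ℝ, ℂ)) + ((v : L2) : 𝓢'(ℝ, ℂ)) :=
      map_add (Lp.toTemperedDistributionCLM ℂ (volume : Measure ℝ) 2) _ _
    rw [hs, hd, ← (exists_secondDeriv u).choose_spec, ← (exists_secondDeriv v).choose_spec,
      LineDeriv.lineDerivOp_add, LineDeriv.lineDerivOp_add]
  map_smul' c u := by
    apply toTemperedDistribution_injective
    rw [← (exists_secondDeriv (c • u)).choose_spec]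
    have hs : ((c • (exists_secondDeriv u).choose : L2) : 𝓢'(ℝ, ℂ)) =
        c • ((exists_secondDeriv u).choose : 𝓢'(ℝ, ℂ)) :=
      map_smul (Lp.toTemperedDistributionCLM ℂ (volume : Measure ℝ) 2) _ _
    have hd : (((c • u : domain) : L2) : 𝓢'(ℝ, ℂ)) = c • ((u : L2) : 𝓢'(ℝ, ℂ)) :=
      map_smul (Lp.toTemperedDistributionCLM ℂ (volume : Measure ℝ) 2) _ _
    rw [RingHom.id_apply, hs, hd, ← (exists_secondDeriv u).choose_spec,
      LineDeriv.lineDerivOp_smul, LineDeriv.lineDerivOp_smul]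

/-- The multiplication `u ↦ x² u`. -/
def sqMul : domain →ₗ[ℂ] L2 where
  toFun u := u.2.2.toLp (fun x : ℝ => ((x ^ 2 : ℝ) : ℂ) * (u : L2) x)
  map_add' u v := by
    rw [← MemLp.toLp_add, MemLp.toLp_eq_toLp_iff]
    filter_upwards [Lp.coeFn_add (u : L2) (v : L2)] with x hx
    simp only [Submodule.coe_add, Pi.add_apply, hx, mul_add]
  map_smul' c u := by
    rw [RingHom.id_apply, ← MemLp.toLp_const_smul, MemLp.toLp_eq_toLp_iff]
    filter_upwards [Lp.coeFn_smul c (u : L2)] with x hx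
    simp [hx, mul_left_comm]

theorem memLp_bddMul (f : ℝ →ᵇ ℝ) (u : L2) :
    MemLp (fun x : ℝ => ((f x : ℝ) : ℂ) * u x) 2 volume := by
  refine MemLp.of_le_mul (c := ‖f‖) (Lp.memLp u) ?_ ?_
  · exact (Complex.continuous_ofReal.comp f.continuous).aestronglyMeasurable.mul
      (Lp.aestronglyMeasurable u)
  · filter_upwards with x
    rw [norm_mul, Complex.norm_real]
    gcongr
    exact f.norm_coe_le_norm x

/-- The multiplication `u ↦ f u` by a bounded continuous real function. -/
def bddMul (f : ℝ →ᵇ ℝ) : L2 →ₗ[ℂ] L2 where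
  toFun u := (memLp_bddMul f u).toLp (fun x : ℝ => ((f x : ℝ) : ℂ) * u x)
  map_add' u v := by
    rw [← MemLp.toLp_add, MemLp.toLp_eq_toLp_iff]
    filter_upwards [Lp.coeFn_add u v] with x hx
    simp only [Pi.add_apply, hx, mul_add]
  map_smul' c u := by
    rw [RingHom.id_apply, ← MemLp.toLp_const_smul, MemLp.toLp_eq_toLp_iff]
    filter_upwards [Lp.coeFn_smul c u] with x hx
    simp [hx, mul_left_comm]

/-- The unbounded operator `H_ε = -∂ₓ² + x² + (i/ε) f(x)` on `L²(ℝ)` with domain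
`{u ∈ H²(ℝ) ; x² u ∈ L²(ℝ)}`. -/
def H (f : ℝ →ᵇ ℝ) (ε : ℝ) : L2 →ₗ.[ℂ] L2 where
  domain := domain
  toFun := -secondDeriv + sqMul + (Complex.I / (ε : ℂ)) • (bddMul f ∘ₗ domain.subtype)

/-- `R` is the resolvent `(A - z)⁻¹`: a bounded two-sided inverse of `A - z : D(A) → L²(ℝ)`. -/
def IsResolventAt (A : L2 →ₗ.[ℂ] L2) (z : ℂ) (R : L2 →L[ℂ] L2) : Prop :=
  (∀ v : L2, ∃ h : R v ∈ A.domain, A ⟨R v, h⟩ - z • R v = v) ∧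
  ∀ u : A.domain, R (A u - z • (u : L2)) = u

/-- The resolvent set of an unbounded operator on `L²(ℝ)`. -/
def resolventSet (A : L2 →ₗ.[ℂ] L2) : Set ℂ :=
  {z | ∃ R : L2 →L[ℂ] L2, IsResolventAt A z R}

/-- The resolvent at a point is unique, so the infimum in `resolventNorm` is over at most one
operator. -/
theorem IsResolventAt.unique {A : L2 →ₗ.[ℂ] L2} {z : ℂ} {R S : L2 →L[ℂ] L2}
    (hR : IsResolventAt A z R) (hS : IsResolventAt A z S) : R = S := by
  ext1 v
  obtain ⟨h, hv⟩ := hR.1 v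
  have := hS.2 ⟨R v, h⟩
  rw [hv] at this
  exact this.symm

/-- The norm `‖(A - z)⁻¹‖`, with the value `∞` when `z` is in the spectrum of `A`. -/
def resolventNorm (A : L2 →ₗ.[ℂ] L2) (z : ℂ) : ℝ≥0∞ :=
  ⨅ (R : L2 →L[ℂ] L2) (_ : IsResolventAt A z R), ‖R‖ₑ

/-- `Ψ(ε) = (sup_{λ ∈ ℝ} ‖(H_ε - iλ)⁻¹‖)⁻¹`. -/
def Psi (f : ℝ →ᵇ ℝ) (ε : ℝ) : ℝ≥0∞ :=
  (⨆ l : ℝ, resolventNorm (H f ε) (Complex.I * (l : ℂ)))⁻¹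

end SkewOscillator

end

/-!
The imaginary part of `H_ε - i l` is multiplication by the bounded real function
`g = f / ε - l`, so everything concerns `H₀ + i g`, where `H₀ = -∂ₓ² + x²`.

*The resolvent.* On Schwartz functions, integration by parts gives `H₀ ≥ 1` (Heisenberg's
inequality, `norm_sq_le_form`) and controls `‖φ''‖` and `‖x² φ‖` by `‖H₀ φ‖` (`norm_osc_sq`).
The range of `H₀` on Schwartz functions is dense (`dense_range_osc`): if `v` is orthogonal to it,
then testing with the modulated Gaussians `exp (i s x - x² / 2)` shows that
`F(s) = ∫ v̄ exp (i s x - x² / 2)` solves `(1 + s²) F + 2 s F' = 0`; hence `s exp (s² / 2) F²` is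
constant, `F = 0`, and `v = 0` by injectivity of the Fourier transform. With the a priori
estimates it follows that `H₀` is bijective from its domain onto `L²(ℝ)` and that Schwartz
functions are a core (`exists_schwartz_tendsto`). Since `Re ⟪u, (H₀ + i g) u⟫ ≥ ‖u‖²`, the bounded
operator `1 + i g H₀⁻¹` is bounded below, and its adjoint is injective by the same bound for `-g`;
this makes `H₀ + i g` bijective too (`skew_surjective`), with inverse of norm at most `1`.

*A level set with interior.* If `f = c` on an interval and `φ` is a bump function supported there,
then `(H_ε - i c / ε) φ = H₀ φ` for all `ε`, and `Ψ(ε) ≤ ‖H₀ φ‖ / ‖φ‖` (`exists_Psi_le`).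

*No level set with interior.* If `Ψ(ε)` does not tend to `∞`, there are normalized Schwartz
functions `φₙ` with `‖(H_{εₙ} - i lₙ) φₙ‖ ≤ M` and `εₙ → 0`. The real part of the quadratic form
bounds `‖φₙ'‖` and `‖x φₙ‖`, so the `φₙ` are uniformly Hölder continuous (`norm_sub_le_sqrt`) and
have values of modulus at least `δ` at points of a fixed compact interval (`exists_le_norm_sq`);
after passing to a subsequence they stay, up to a phase, in a half plane away from zero on a fixed
interval. The imaginary part bounds `εₙ lₙ`, so one may assume `εₙ lₙ → c`. Testing the equation
against a bump function `χ` gives `∫ χ (f - εₙ lₙ) φₙ = O(εₙ)` (`norm_inner_bddMul_le`), which is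
impossible if `χ` is supported near a point of that interval where `f ≠ c`
(`not_exists_quasimodes`).
-/

noncomputable section

namespace SkewOscillator

/-! ### Derivative and multiplication operators on Schwartz functions -/

/-- The derivative `φ ↦ φ'` on Schwartz functions. -/
def D : 𝓢(ℝ, ℂ) →L[ℂ] 𝓢(ℝ, ℂ) := SchwartzMap.derivCLM ℂ ℂ

/-- The position operator `φ ↦ x φ` on Schwartz functions. -/
def X : 𝓢(ℝ, ℂ) →L[ℂ] 𝓢(ℝ, ℂ) := SchwartzMap.smulLeftCLM ℂ (fun x : ℝ => (x : ℂ))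

/-- The harmonic oscillator `φ ↦ -φ'' + x² φ` on Schwartz functions. -/
def osc : 𝓢(ℝ, ℂ) →L[ℂ] 𝓢(ℝ, ℂ) := -(D ∘L D) + X ∘L X

/-- The embedding of Schwartz functions into `L²(ℝ)`. -/
def toL2 : 𝓢(ℝ, ℂ) →L[ℂ] L2 := SchwartzMap.toLpCLM ℂ ℂ 2 volume

theorem osc_apply (φ : 𝓢(ℝ, ℂ)) : osc φ = -D (D φ) + X (X φ) := rfl

theorem D_apply (φ : 𝓢(ℝ, ℂ)) (x : ℝ) : D φ x = deriv φ x := rfl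

theorem X_apply (φ : 𝓢(ℝ, ℂ)) (x : ℝ) : X φ x = x * φ x := by
  rw [X, SchwartzMap.smulLeftCLM_apply_apply (by fun_prop), smul_eq_mul]

theorem toL2_coeFn (φ : 𝓢(ℝ, ℂ)) : toL2 φ =ᵐ[volume] φ :=
  φ.coeFn_toLp 2 volume

theorem toL2_distribution (φ : 𝓢(ℝ, ℂ)) :
    ((toL2 φ : L2) : 𝓢'(ℝ, ℂ)) = (φ : 𝓢'(ℝ, ℂ)) :=
  Lp.toTemperedDistribution_toLp_eq φ

theorem lineDerivOp_eq_D (φ : 𝓢(ℝ, ℂ)) : ∂_{(1 : ℝ)} φ = D φ := by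
  ext x
  rw [SchwartzMap.lineDerivOp_apply_eq_fderiv, D_apply]
  rfl

theorem inner_toL2 (φ ψ : 𝓢(ℝ, ℂ)) :
    inner ℂ (toL2 φ) (toL2 ψ) = ∫ x, inner ℂ (φ x) (ψ x) :=
  SchwartzMap.inner_toL2_toL2_eq φ ψ volume

theorem inner_D_left (φ ψ : 𝓢(ℝ, ℂ)) :
    inner ℂ (toL2 (D φ)) (toL2 ψ) = -inner ℂ (toL2 φ) (toL2 (D ψ)) := by
  rw [inner_toL2, inner_toL2]
  have h := SchwartzMap.integral_bilinear_deriv_right_eq_neg_left φ ψ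
    ((ContinuousLinearMap.mul ℝ ℂ).comp (Complex.conjCLE : ℂ →L[ℝ] ℂ))
  simp only [RCLike.inner_apply, D_apply]
  simp only [ContinuousLinearMap.comp_apply, ContinuousLinearMap.mul_apply',
    ContinuousLinearEquiv.coe_coe, Complex.conjCLE_apply] at h
  simp only [mul_comm _ ((starRingEnd ℂ) _)]
  rw [h, neg_neg]

theorem inner_X_left (φ ψ : 𝓢(ℝ, ℂ)) :
    inner ℂ (toL2 (X φ)) (toL2 ψ) = inner ℂ (toL2 φ) (toL2 (X ψ)) := by
  rw [inner_toL2, inner_toL2]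
  congr 1
  ext x
  simp only [RCLike.inner_apply, X_apply, map_mul, Complex.conj_ofReal]
  ring

theorem D_X (φ : 𝓢(ℝ, ℂ)) : D (X φ) = X (D φ) + φ := by
  ext x
  have h : HasDerivAt (fun x : ℝ => (x : ℂ) * φ x) (1 * φ x + x * deriv φ x) x :=
    (Complex.ofRealCLM.hasDerivAt (x := x)).mul (φ.hasDerivAt x)
  have h2 : (X φ : ℝ → ℂ) = fun x : ℝ => (x : ℂ) * φ x := funext (X_apply φ)
  rw [D_apply, h2, h.deriv, add_apply, X_apply, D_apply]
  ring

/-- Integration by parts of `x (|φ|²)'`. -/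
theorem re_inner_D_X (φ : 𝓢(ℝ, ℂ)) :
    2 * (inner ℂ (toL2 (D φ)) (toL2 (X φ))).re = -‖toL2 φ‖ ^ 2 := by
  have h1 : inner ℂ (toL2 (D φ)) (toL2 (X φ)) =
      -inner ℂ (toL2 (X φ)) (toL2 (D φ)) - inner ℂ (toL2 φ) (toL2 φ) := by
    rw [inner_D_left, D_X, map_add, inner_add_right, inner_X_left]
    ring
  have h2 := congrArg Complex.re h1
  have h3 : (inner ℂ (toL2 (X φ)) (toL2 (D φ))).re = (inner ℂ (toL2 (D φ)) (toL2 (X φ))).re :=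
    inner_re_symm (𝕜 := ℂ) _ _
  have h4 : (inner ℂ (toL2 φ) (toL2 φ)).re = ‖toL2 φ‖ ^ 2 := inner_self_eq_norm_sq (𝕜 := ℂ) _
  rw [Complex.sub_re, Complex.neg_re, h3, h4] at h2
  linarith

theorem inner_osc_symm (φ ψ : 𝓢(ℝ, ℂ)) :
    inner ℂ (toL2 (osc φ)) (toL2 ψ) = inner ℂ (toL2 φ) (toL2 (osc ψ)) := by
  simp only [osc_apply, map_add, map_neg, inner_add_left, inner_add_right, inner_neg_left,
    inner_neg_right, inner_D_left, inner_X_left, neg_neg]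

/-- The quadratic form of the harmonic oscillator. -/
theorem inner_osc_self (φ : 𝓢(ℝ, ℂ)) :
    inner ℂ (toL2 φ) (toL2 (osc φ)) = ((‖toL2 (D φ)‖ ^ 2 + ‖toL2 (X φ)‖ ^ 2 : ℝ) : ℂ) := by
  have h1 := inner_D_left φ (D φ)
  have h2 := inner_X_left φ (X φ)
  rw [osc_apply, map_add, map_neg, inner_add_right, inner_neg_right, ← h1, ← h2,
    inner_self_eq_norm_sq_to_K, inner_self_eq_norm_sq_to_K]
  push_cast
  rfl

/-- The Heisenberg inequality, in the form `H₀ ≥ 1`. -/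
theorem norm_sq_le_form (φ : 𝓢(ℝ, ℂ)) :
    ‖toL2 φ‖ ^ 2 ≤ ‖toL2 (D φ)‖ ^ 2 + ‖toL2 (X φ)‖ ^ 2 := by
  have h1 := re_inner_D_X φ
  have h2 := norm_add_sq (𝕜 := ℂ) (toL2 (D φ)) (toL2 (X φ))
  have h3 := sq_nonneg ‖toL2 (D φ) + toL2 (X φ)‖
  rw [h2] at h3
  have h4 : RCLike.re (inner ℂ (toL2 (D φ)) (toL2 (X φ))) =
    (inner ℂ (toL2 (D φ)) (toL2 (X φ))).re := rfl
  rw [h4] at h3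
  linarith

theorem norm_le_of_norm_sq_le_re_inner {u v : L2} (h : ‖u‖ ^ 2 ≤ (inner ℂ u v).re) :
    ‖u‖ ≤ ‖v‖ := by
  have h2 : (inner ℂ u v).re ≤ ‖u‖ * ‖v‖ := re_inner_le_norm (𝕜 := ℂ) _ _
  rcases (norm_nonneg u).eq_or_lt with h0 | h0
  · rw [← h0]
    exact norm_nonneg _
  · exact le_of_mul_le_mul_left (by nlinarith) h0

theorem norm_le_norm_osc (φ : 𝓢(ℝ, ℂ)) : ‖toL2 φ‖ ≤ ‖toL2 (osc φ)‖ := by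
  refine norm_le_of_norm_sq_le_re_inner ?_
  rw [inner_osc_self, Complex.ofReal_re]
  exact norm_sq_le_form φ

theorem norm_osc_sq (φ : 𝓢(ℝ, ℂ)) :
    ‖toL2 (osc φ)‖ ^ 2 = ‖toL2 (D (D φ))‖ ^ 2 + ‖toL2 (X (X φ))‖ ^ 2 +
      2 * ‖toL2 (X (D φ))‖ ^ 2 - 2 * ‖toL2 φ‖ ^ 2 := by
  have h0 : D (X (X φ)) = X (X (D φ)) + (2 : ℂ) • X φ := by
    rw [D_X, D_X, map_add, two_smul, add_assoc]
  have h1 : inner ℂ (toL2 (D (D φ))) (toL2 (X (X φ))) =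
      -inner ℂ (toL2 (X (D φ))) (toL2 (X (D φ))) - 2 * inner ℂ (toL2 (D φ)) (toL2 (X φ)) := by
    rw [inner_D_left, h0, map_add, map_smul, inner_add_right, inner_smul_right, inner_X_left]
    ring
  have h2 := congrArg Complex.re h1
  have h4 : (inner ℂ (toL2 (X (D φ))) (toL2 (X (D φ)))).re = ‖toL2 (X (D φ))‖ ^ 2 :=
    inner_self_eq_norm_sq (𝕜 := ℂ) _
  have h5 : (2 * inner ℂ (toL2 (D φ)) (toL2 (X φ)) : ℂ).re =
    2 * (inner ℂ (toL2 (D φ)) (toL2 (X φ))).re := by simp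
  rw [Complex.sub_re, Complex.neg_re, h4, h5, re_inner_D_X] at h2
  have h6 : toL2 (osc φ) = toL2 (X (X φ)) - toL2 (D (D φ)) := by
    rw [osc_apply, map_add, map_neg]
    abel
  have h7 := norm_sub_sq (𝕜 := ℂ) (toL2 (X (X φ))) (toL2 (D (D φ)))
  rw [inner_re_symm] at h7
  have h8 : RCLike.re (inner ℂ (toL2 (D (D φ))) (toL2 (X (X φ)))) =
    (inner ℂ (toL2 (D (D φ))) (toL2 (X (X φ)))).re := rfl
  rw [h6, h7, h8, h2]
  ring

theorem norm_DD_le (φ : 𝓢(ℝ, ℂ)) : ‖toL2 (D (D φ))‖ ≤ 2 * ‖toL2 (osc φ)‖ := by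
  have h1 := norm_osc_sq φ
  have h2 := norm_le_norm_osc φ
  refine abs_le_of_sq_le_sq' ?_ (by positivity) |>.2
  nlinarith [sq_nonneg ‖toL2 (X (X φ))‖, sq_nonneg ‖toL2 (X (D φ))‖, norm_nonneg (toL2 φ)]

theorem norm_XX_le (φ : 𝓢(ℝ, ℂ)) : ‖toL2 (X (X φ))‖ ≤ 2 * ‖toL2 (osc φ)‖ := by
  have h1 := norm_osc_sq φ
  have h2 := norm_le_norm_osc φ
  refine abs_le_of_sq_le_sq' ?_ (by positivity) |>.2
  nlinarith [sq_nonneg ‖toL2 (D (D φ))‖, sq_nonneg ‖toL2 (X (D φ))‖, norm_nonneg (toL2 φ)]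

/-! ### Modulated Gaussians -/

theorem exists_bound_polynomial_mul_gaussian (p : Polynomial ℝ) :
    ∃ C : ℝ, ∀ x : ℝ, |p.eval x| * Real.exp (-(x ^ 2 / 2)) ≤ C := by
  induction p using Polynomial.induction_on' with
  | add p q hp hq =>
    obtain ⟨C, hC⟩ := hp
    obtain ⟨C', hC'⟩ := hq
    refine ⟨C + C', fun x => ?_⟩
    rw [Polynomial.eval_add]
    have := abs_add_le (p.eval x) (q.eval x)
    nlinarith [hC x, hC' x, Real.exp_pos (-(x ^ 2 / 2))]
  | monomial n a =>
    refine ⟨|a| * (n.factorial * Real.exp (1 / 2)), fun x => ?_⟩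
    have h1 : |x| ^ n ≤ n.factorial * Real.exp |x| := by
      have := Real.pow_div_factorial_le_exp |x| (abs_nonneg x) n
      rw [div_le_iff₀ (by positivity)] at this
      linarith
    have h2 : Real.exp |x| * Real.exp (-(x ^ 2 / 2)) ≤ Real.exp (1 / 2) := by
      rw [← Real.exp_add]
      apply Real.exp_le_exp.mpr
      nlinarith [sq_nonneg (|x| - 1), sq_abs x]
    rw [Polynomial.eval_monomial, abs_mul, abs_pow, mul_assoc]
    refine mul_le_mul_of_nonneg_left ?_ (abs_nonneg a)
    calc |x| ^ n * Real.exp (-(x ^ 2 / 2))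
        ≤ n.factorial * Real.exp |x| * Real.exp (-(x ^ 2 / 2)) := by gcongr
      _ = n.factorial * (Real.exp |x| * Real.exp (-(x ^ 2 / 2))) := by ring
      _ ≤ _ := by gcongr

/-- The Gaussian `exp (-x² / 2)` as a real Schwartz function. -/
def realGaussian : 𝓢(ℝ, ℝ) where
  toFun x := Real.exp (-(x ^ 2 / 2))
  smooth' := by fun_prop
  decay' k n := by
    obtain ⟨C, hC⟩ := exists_bound_polynomial_mul_gaussian
      (Polynomial.X ^ k * (Polynomial.hermite n).map (algebraMap ℤ ℝ))
    refine ⟨C, fun x => ?_⟩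
    rw [norm_iteratedFDeriv_eq_norm_iteratedDeriv, iteratedDeriv_eq_iterate,
      Polynomial.deriv_gaussian_eq_hermite_mul_gaussian]
    refine le_trans (le_of_eq ?_) (hC x)
    rw [Polynomial.eval_mul, Polynomial.eval_pow, Polynomial.eval_X,
      Polynomial.eval_map_algebraMap, abs_mul, abs_pow, norm_mul, norm_mul, norm_pow, norm_neg,
      norm_one, one_pow, one_mul, Real.norm_eq_abs, Real.norm_eq_abs, Real.norm_eq_abs,
      abs_of_pos (Real.exp_pos _)]
    ring

/-- The Gaussian `exp (-x² / 2)` as a complex Schwartz function. -/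
def gaussian : 𝓢(ℝ, ℂ) := realGaussian.postcompCLM Complex.ofRealCLM

theorem gaussian_apply (x : ℝ) : gaussian x = Complex.exp (-(x ^ 2 / 2)) := by
  change ((Real.exp (-(x ^ 2 / 2)) : ℝ) : ℂ) = _
  push_cast
  rfl

theorem hasTemperateGrowth_cexp_mul_I (s : ℝ) :
    Function.HasTemperateGrowth (fun x : ℝ => Complex.exp ((s * x : ℝ) * Complex.I)) := by
  have hn : ∀ n : ℕ, iteratedDeriv n (fun x : ℝ => Complex.exp ((s * x : ℝ) * Complex.I)) =
      fun x : ℝ => (s * Complex.I) ^ n * Complex.exp ((s * x : ℝ) * Complex.I) := by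
    intro n
    induction n with
    | zero => simp
    | succ n ih =>
      rw [iteratedDeriv_succ, ih]
      ext x
      have h : HasDerivAt (fun x : ℝ => (s * Complex.I) ^ n *
          Complex.exp ((s * x : ℝ) * Complex.I))
          ((s * Complex.I) ^ n * (Complex.exp ((s * x : ℝ) * Complex.I) *
            ((s * 1 : ℝ) * Complex.I))) x :=
        ((((hasDerivAt_id x).const_mul s).ofReal_comp.mul_const Complex.I).cexp).const_mul _
      rw [h.deriv]
      push_cast
      ring
  have hs : ContDiff ℝ (⊤ : ℕ∞) (fun x : ℝ => Complex.ofRealCLM (s * x)) := by fun_prop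
  refine ⟨Complex.contDiff_exp.comp (hs.mul contDiff_const), fun n => ⟨0, |s| ^ n, fun x => ?_⟩⟩
  rw [norm_iteratedFDeriv_eq_norm_iteratedDeriv, hn, norm_mul, Complex.norm_exp_ofReal_mul_I]
  simp

/-- The modulated Gaussian `exp (i s x - x² / 2)`. -/
def wave (s : ℝ) : 𝓢(ℝ, ℂ) :=
  SchwartzMap.smulLeftCLM ℂ (fun x : ℝ => Complex.exp ((s * x : ℝ) * Complex.I)) gaussian

theorem wave_apply (s x : ℝ) :
    wave s x = Complex.exp ((s * x : ℝ) * Complex.I) * gaussian x := by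
  rw [wave, SchwartzMap.smulLeftCLM_apply_apply (hasTemperateGrowth_cexp_mul_I s), smul_eq_mul]

theorem D_wave (s : ℝ) : D (wave s) = (s * Complex.I) • wave s - X (wave s) := by
  ext x
  have h2 : (wave s : ℝ → ℂ) = fun x : ℝ =>
      Complex.exp ((s * x : ℝ) * Complex.I + -((x : ℂ) ^ 2 / 2)) := by
    ext x
    rw [wave_apply, gaussian_apply, Complex.exp_add]
  have h1 : HasDerivAt (fun x : ℝ => ((s * x : ℝ) * Complex.I + -((x : ℂ) ^ 2 / 2) : ℂ))
      ((s * 1 : ℝ) * Complex.I + -((2 : ℕ) * (x : ℂ) ^ (2 - 1) * 1 / 2)) x :=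
    (((hasDerivAt_id x).const_mul s).ofReal_comp.mul_const Complex.I).add
      (((Complex.ofRealCLM.hasDerivAt (x := x)).pow 2).div_const 2).neg
  have h3 := h1.cexp
  rw [D_apply, sub_apply, smul_apply, X_apply, h2, h3.deriv]
  push_cast
  simp only [smul_eq_mul]
  ring

theorem osc_wave (s : ℝ) :
    osc (wave s) = (1 + s ^ 2 : ℂ) • wave s + (2 * s * Complex.I) • X (wave s) := by
  rw [osc_apply, D_wave, map_sub, D_X, map_smul, D_wave, map_sub, map_smul]
  ext x
  simp only [add_apply, sub_apply, neg_apply, smul_apply, smul_eq_mul]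
  linear_combination (-(s : ℂ) ^ 2 * wave s x) * Complex.I_sq

/-! ### Density of the range of the harmonic oscillator -/

/-- An integrable function with vanishing Fourier transform vanishes. -/
theorem ae_eq_zero_of_fourier_eq_zero {w : ℝ → ℂ} (hw : Integrable w)
    (h : ∀ ξ, FourierTransform.fourier w ξ = 0) : w =ᵐ[volume] 0 := by
  set u : Lp ℂ 1 (volume : Measure ℝ) := (memLp_one_iff_integrable.2 hw).toLp w with hu
  have huw : u =ᵐ[volume] w := MemLp.coeFn_toLp _
  have h0 : (u : 𝓢'(ℝ, ℂ)) = 0 := by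
    ext φ
    obtain ⟨ψ, rfl⟩ : ∃ ψ : 𝓢(ℝ, ℂ), FourierTransform.fourier ψ = φ :=
      ⟨FourierTransform.fourierInv φ, FourierTransform.fourier_fourierInv_eq φ⟩
    rw [Lp.toTemperedDistribution_apply]
    have h1 : ∫ x, (FourierTransform.fourier ψ) x • u x =
        ∫ x, FourierTransform.fourier (ψ : ℝ → ℂ) x • w x := by
      refine integral_congr_ae ?_
      filter_upwards [huw] with x hx
      rw [hx]
      rfl
    have h2 : ∫ x, FourierTransform.fourier (ψ : ℝ → ℂ) x • w x =
        ∫ x, ψ x • FourierTransform.fourier w x := by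
      simpa using! VectorFourier.integral_fourierIntegral_smul_eq_flip (L := innerₗ ℝ)
        Real.continuous_fourierChar continuous_inner (ψ.integrable (μ := volume)) hw
    rw [h1, h2]
    simp [h]
  have h3 : u = 0 := by
    refine LinearMap.ker_eq_bot'.mp
      (Lp.ker_toTemperedDistributionCLM_eq_bot (F := ℂ) (μ := (volume : Measure ℝ)) (p := 1)) u h0
  rw [h3] at huw
  exact huw.symm.trans (Lp.coeFn_zero _ _ _)

theorem inner_toL2_right (v : L2) (φ : 𝓢(ℝ, ℂ)) :
    inner ℂ v (toL2 φ) = ∫ x, (starRingEnd ℂ) (v x) * φ x := by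
  rw [L2.inner_def]
  refine integral_congr_ae ?_
  filter_upwards [toL2_coeFn φ] with x hx
  rw [hx, RCLike.inner_apply, mul_comm]

theorem integrable_conj_mul (v : L2) (φ : 𝓢(ℝ, ℂ)) :
    Integrable fun x => (starRingEnd ℂ) (v x) * φ x := by
  refine (L2.integrable_inner (𝕜 := ℂ) v (toL2 φ)).congr ?_
  filter_upwards [toL2_coeFn φ] with x hx
  rw [hx, RCLike.inner_apply, mul_comm]

/-- A solution of `2 ξ F' + (1 + a² ξ²) F = 0` that is regular at `ξ = 0` vanishes, because
`ξ exp (a² ξ² / 2) F²` is constant. -/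
theorem eq_zero_of_singular_ode {F F' : ℝ → ℂ} (a : ℝ) (hF : ∀ ξ, HasDerivAt F (F' ξ) ξ)
    (h : ∀ ξ : ℝ, (1 + (a : ℂ) ^ 2 * ξ ^ 2) * F ξ + 2 * ξ * F' ξ = 0) (ξ : ℝ) : F ξ = 0 := by
  have hd : ∀ x : ℝ, HasDerivAt (fun x : ℝ => (x : ℂ) * Complex.exp (a ^ 2 * (x : ℂ) ^ 2 / 2) *
      F x ^ 2) 0 x := by
    intro x
    have h1 : HasDerivAt (fun x : ℝ => (x : ℂ)) 1 x := Complex.ofRealCLM.hasDerivAt (x := x)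
    have h2 := (h1.mul (((h1.pow 2).const_mul ((a : ℂ) ^ 2)).div_const 2).cexp).mul ((hF x).pow 2)
    refine h2.congr_deriv ?_
    simp only [Pi.mul_apply, Pi.pow_apply]
    push_cast
    linear_combination (F x * Complex.exp (a ^ 2 * (x : ℂ) ^ 2 / 2)) * h x
  have hc := is_const_of_deriv_eq_zero (fun x => (hd x).differentiableAt)
    (fun x => (hd x).deriv) ξ 0
  simp only [Complex.ofReal_zero, zero_mul, mul_eq_zero, Complex.exp_ne_zero, or_false,
    pow_eq_zero_iff two_ne_zero, Complex.ofReal_eq_zero] at hc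
  rcases hc with rfl | hc
  · simpa using h 0
  · exact hc

/-- An `L²` function orthogonal to the range of the harmonic oscillator vanishes. Testing against
the modulated Gaussians shows that the Fourier transform of `v̄ exp (-x² / 2)` solves a singular
first order differential equation without nonzero regular solutions. -/
theorem eq_zero_of_inner_osc_eq_zero (v : L2)
    (h : ∀ φ, inner ℂ v (toL2 (osc φ)) = 0) : v = 0 := by
  set w : ℝ → ℂ := fun x => (starRingEnd ℂ) (v x) * gaussian x with hw
  have hw1 : Integrable w := integrable_conj_mul v gaussian
  have hw2 : Integrable (fun x : ℝ => x • w x) := by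
    refine (integrable_conj_mul v (X gaussian)).congr (Eventually.of_forall fun x => ?_)
    simp only [hw, X_apply, Complex.real_smul]
    ring
  have hF := Real.hasDerivAt_fourier hw1 hw2
  have hode : ∀ ξ : ℝ, (1 + ((2 * Real.pi : ℝ) : ℂ) ^ 2 * ξ ^ 2) * FourierTransform.fourier w ξ +
      2 * ξ * FourierTransform.fourier
        (fun x : ℝ => (-2 * Real.pi * Complex.I * x) • w x) ξ = 0 := by
    intro ξ
    have e1 : inner ℂ v (toL2 (wave (-2 * Real.pi * ξ))) = FourierTransform.fourier w ξ := by
      rw [inner_toL2_right, Real.fourier_real_eq_integral_exp_smul]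
      congr 1
      ext x
      rw [wave_apply, hw, smul_eq_mul]
      simp only
      rw [show -2 * Real.pi * ξ * x = -2 * Real.pi * x * ξ by ring]
      ring
    have e2 : FourierTransform.fourier (fun x : ℝ => (-2 * Real.pi * Complex.I * x) • w x) ξ =
        (-2 * Real.pi * Complex.I) * inner ℂ v (toL2 (X (wave (-2 * Real.pi * ξ)))) := by
      rw [inner_toL2_right, Real.fourier_real_eq_integral_exp_smul, ← integral_const_mul]
      congr 1
      ext x
      rw [X_apply, wave_apply, hw, smul_eq_mul, smul_eq_mul]
      simp only
      rw [show -2 * Real.pi * ξ * x = -2 * Real.pi * x * ξ by ring]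
      ring
    have h0 := h (wave (-2 * Real.pi * ξ))
    rw [osc_wave, map_add, map_smul, map_smul, inner_add_right, inner_smul_right,
      inner_smul_right, e1] at h0
    rw [e2]
    push_cast at h0 ⊢
    linear_combination h0
  have hz := ae_eq_zero_of_fourier_eq_zero hw1 (eq_zero_of_singular_ode (2 * Real.pi) hF hode)
  rw [Lp.eq_zero_iff_ae_eq_zero]
  filter_upwards [hz] with x hx
  have hx' : (starRingEnd ℂ) (v x) * gaussian x = 0 := hx
  rw [gaussian_apply] at hx'
  simpa using hx'

theorem dense_range_osc : DenseRange fun φ => toL2 (osc φ) := by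
  have h : (LinearMap.range ((toL2 ∘L osc).toLinearMap)).topologicalClosure = ⊤ := by
    rw [Submodule.topologicalClosure_eq_top_iff, Submodule.eq_bot_iff]
    intro v hv
    refine eq_zero_of_inner_osc_eq_zero v fun φ => ?_
    exact (Submodule.mem_orthogonal' _ _).mp hv _ ⟨φ, rfl⟩
  have h2 := (Submodule.dense_iff_topologicalClosure_eq_top).mpr h
  exact h2

/-! ### The harmonic oscillator on its domain -/

theorem besselPotential_two_apply (T : 𝓢'(ℝ, ℂ)) :
    TemperedDistribution.besselPotential ℝ ℂ 2 T =
      T + (-((2 * Real.pi) ^ 2 : ℂ)⁻¹) • ∂_{(1 : ℝ)} (∂_{(1 : ℝ)} T) := by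
  have h1 : ∂_{(1 : ℝ)} (∂_{(1 : ℝ)} T) = (-((2 * Real.pi) ^ 2 : ℂ)) •
      TemperedDistribution.fourierMultiplierCLM ℂ (fun x : ℝ => ((x ^ 2 : ℝ) : ℂ)) T := by
    rw [TemperedDistribution.lineDeriv_eq_fourierMultiplierCLM,
      TemperedDistribution.lineDeriv_eq_fourierMultiplierCLM, map_smul,
      TemperedDistribution.fourierMultiplierCLM_fourierMultiplierCLM_apply (by fun_prop)
        (by fun_prop), smul_smul]
    congr 1
    · linear_combination (2 * Real.pi : ℂ) ^ 2 * Complex.I_sq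
    · congr 2
      ext x
      simp [sq]
  have h2 : ((-((2 * Real.pi) ^ 2 : ℂ)⁻¹)) * (-((2 * Real.pi) ^ 2 : ℂ)) = 1 := by
    have : (2 * Real.pi : ℂ) ≠ 0 := by simp [Real.pi_ne_zero]
    field_simp
  rw [h1, smul_smul, h2, one_smul, TemperedDistribution.besselPotential]
  have h3 : (fun x : ℝ => (((1 + ‖x‖ ^ 2) ^ ((2 : ℝ) / 2) : ℝ) : ℂ)) =
      (fun _ : ℝ => (1 : ℂ)) + fun x : ℝ => ((x ^ 2 : ℝ) : ℂ) := by
    ext x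
    simp
  rw [h3, TemperedDistribution.fourierMultiplierCLM_apply,
    TemperedDistribution.fourierMultiplierCLM_apply,
    TemperedDistribution.smulLeftCLM_add (by fun_prop) (by fun_prop),
    add_apply, TemperedDistribution.smulLeftCLM_const, one_smul,
    FourierTransform.fourierInv_add, FourierTransform.fourierInv_fourier_eq]

/-- An `L²` function with second distributional derivative in `L²` lies in `H²(ℝ)`. -/
theorem memSobolev_two_of_secondDeriv {u b : L2}
    (h : ∂_{(1 : ℝ)} (∂_{(1 : ℝ)} (u : 𝓢'(ℝ, ℂ))) = (b : 𝓢'(ℝ, ℂ))) :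
    TemperedDistribution.MemSobolev 2 2 (u : 𝓢'(ℝ, ℂ)) := by
  refine ⟨u + (-((2 * Real.pi) ^ 2 : ℂ)⁻¹) • b, ?_⟩
  rw [besselPotential_two_apply, h]
  simp only [← Lp.toTemperedDistributionCLM_apply, map_add, map_smul]

theorem secondDeriv_spec (u : domain) :
    ∂_{(1 : ℝ)} (∂_{(1 : ℝ)} ((u : L2) : 𝓢'(ℝ, ℂ))) = (secondDeriv u : 𝓢'(ℝ, ℂ)) :=
  (exists_secondDeriv u).choose_spec

theorem secondDeriv_eq {u : domain} {b : L2}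
    (h : ∂_{(1 : ℝ)} (∂_{(1 : ℝ)} ((u : L2) : 𝓢'(ℝ, ℂ))) = (b : 𝓢'(ℝ, ℂ))) :
    secondDeriv u = b :=
  toTemperedDistribution_injective ((secondDeriv_spec u).symm.trans h)

theorem sqMul_coeFn (u : domain) :
    sqMul u =ᵐ[volume] fun x : ℝ => ((x ^ 2 : ℝ) : ℂ) * (u : L2) x :=
  u.2.2.coeFn_toLp

/-- The domain of the harmonic oscillator contains the limits of Schwartz functions along which
both second order terms converge. -/
theorem exists_domain_of_tendsto {φ : ℕ → 𝓢(ℝ, ℂ)} {u a b : L2}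
    (hu : Tendsto (fun n => toL2 (φ n)) atTop (𝓝 u))
    (hb : Tendsto (fun n => toL2 (D (D (φ n)))) atTop (𝓝 b))
    (ha : Tendsto (fun n => toL2 (X (X (φ n)))) atTop (𝓝 a)) :
    ∃ h : u ∈ domain, secondDeriv ⟨u, h⟩ = b ∧ sqMul ⟨u, h⟩ = a := by
  have h1 : ∂_{(1 : ℝ)} (∂_{(1 : ℝ)} (u : 𝓢'(ℝ, ℂ))) = (b : 𝓢'(ℝ, ℂ)) := by
    ext ψ
    have e1 := ((Lp.toTemperedDistributionCLM ℂ (volume : Measure ℝ) 2).continuous.tendsto u).comp hu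
    have e2 := ((Lp.toTemperedDistributionCLM ℂ (volume : Measure ℝ) 2).continuous.tendsto b).comp hb
    have c2 : Continuous fun T : 𝓢'(ℝ, ℂ) => ∂_{(1 : ℝ)} (∂_{(1 : ℝ)} T) :=
      (LineDeriv.lineDerivOpCLM ℂ 𝓢'(ℝ, ℂ) (1 : ℝ)).continuous.comp
        (LineDeriv.lineDerivOpCLM ℂ 𝓢'(ℝ, ℂ) (1 : ℝ)).continuous
    have e3 := (c2.tendsto _).comp e1
    have e4 : ∀ n, ∂_{(1 : ℝ)} (∂_{(1 : ℝ)} ((toL2 (φ n) : L2) : 𝓢'(ℝ, ℂ))) =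
        ((toL2 (D (D (φ n))) : L2) : 𝓢'(ℝ, ℂ)) := by
      intro n
      rw [toL2_distribution, toL2_distribution,
        TemperedDistribution.lineDerivOp_toTemperedDistributionCLM_eq,
        TemperedDistribution.lineDerivOp_toTemperedDistributionCLM_eq, lineDerivOp_eq_D,
        lineDerivOp_eq_D]
    have e5 : Tendsto (fun n => ((toL2 (D (D (φ n))) : L2) : 𝓢'(ℝ, ℂ))) atTop
        (𝓝 (∂_{(1 : ℝ)} (∂_{(1 : ℝ)} (u : 𝓢'(ℝ, ℂ))))) :=
      e3.congr e4
    rw [tendsto_nhds_unique e5 e2]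
    rfl
  have h2 : a =ᵐ[volume] fun x : ℝ => ((x ^ 2 : ℝ) : ℂ) * u x := by
    -- Along a common subsequence both `φ n` and `x² φ n` converge almost everywhere.
    obtain ⟨ns, hns, hns'⟩ := (tendstoInMeasure_of_tendsto_Lp hu).exists_seq_tendsto_ae
    obtain ⟨ms, hms, hms'⟩ := (tendstoInMeasure_of_tendsto_Lp
      (ha.comp hns.tendsto_atTop)).exists_seq_tendsto_ae
    have c1 := ae_all_iff.mpr fun n => toL2_coeFn (φ n)
    have c2 := ae_all_iff.mpr fun n => toL2_coeFn (X (X (φ n)))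
    filter_upwards [hns', hms', c1, c2] with x hx hx' k1 k2
    refine tendsto_nhds_unique hx' ?_
    have := (hx.comp hms.tendsto_atTop).const_mul ((x ^ 2 : ℝ) : ℂ)
    refine this.congr fun i => ?_
    simp only [Function.comp_apply, k1, k2, X_apply]
    push_cast
    ring
  have hmem : u ∈ domain :=
    ⟨memSobolev_two_of_secondDeriv h1, (memLp_congr_ae h2).mp (Lp.memLp a)⟩
  refine ⟨hmem, secondDeriv_eq h1, ?_⟩
  apply Lp.ext
  exact (sqMul_coeFn ⟨u, hmem⟩).trans h2.symm

theorem toL2_mem_domain (φ : 𝓢(ℝ, ℂ)) :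
    ∃ h : toL2 φ ∈ domain, secondDeriv ⟨toL2 φ, h⟩ = toL2 (D (D φ)) ∧
      sqMul ⟨toL2 φ, h⟩ = toL2 (X (X φ)) :=
  exists_domain_of_tendsto (φ := fun _ => φ) tendsto_const_nhds tendsto_const_nhds
    tendsto_const_nhds

/-- The harmonic oscillator `-∂ₓ² + x²` on its domain. -/
def H0 : domain →ₗ[ℂ] L2 := -secondDeriv + sqMul

theorem H0_apply (u : domain) : H0 u = -secondDeriv u + sqMul u := rfl

/-- The harmonic oscillator is surjective, and each preimage is the limit of Schwartz functions
in the graph norm: the a priori estimates turn approximation of the image into convergence. -/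
theorem exists_H0_eq (v : L2) : ∃ u : domain, H0 u = v ∧ ∃ φ : ℕ → 𝓢(ℝ, ℂ),
    Tendsto (fun n => toL2 (φ n)) atTop (𝓝 (u : L2)) ∧
    Tendsto (fun n => toL2 (osc (φ n))) atTop (𝓝 v) := by
  have hv : v ∈ closure (Set.range fun φ => toL2 (osc φ)) := dense_range_osc v
  obtain ⟨y, hy, hyv⟩ := mem_closure_iff_seq_limit.mp hv
  choose φ hφ using hy
  have hφv : Tendsto (fun n => toL2 (osc (φ n))) atTop (𝓝 v) := by
    simpa only [hφ] using hyv
  have key : ∀ A : 𝓢(ℝ, ℂ) →L[ℂ] L2, (∀ ψ, ‖A ψ‖ ≤ 2 * ‖toL2 (osc ψ)‖) →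
      ∃ a, Tendsto (fun n => A (φ n)) atTop (𝓝 a) := by
    intro A hA
    apply cauchySeq_tendsto_of_complete
    rw [Metric.cauchySeq_iff']
    intro ε hε
    obtain ⟨N, hN⟩ := Metric.cauchySeq_iff'.mp hφv.cauchySeq (ε / 2) (by positivity)
    refine ⟨N, fun n hn => ?_⟩
    have h1 := hN n hn
    have h2 := hA (φ n - φ N)
    rw [dist_eq_norm, ← map_sub, ← map_sub] at h1
    rw [dist_eq_norm, ← map_sub]
    linarith
  obtain ⟨u, hu⟩ := key toL2 fun ψ => by
    linarith [norm_le_norm_osc ψ, norm_nonneg (toL2 (osc ψ))]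
  obtain ⟨b, hb⟩ := key (toL2 ∘L D ∘L D) norm_DD_le
  obtain ⟨a, ha⟩ := key (toL2 ∘L X ∘L X) norm_XX_le
  obtain ⟨h, h1, h2⟩ := exists_domain_of_tendsto hu hb ha
  refine ⟨⟨u, h⟩, ?_, φ, hu, hφv⟩
  rw [H0_apply, h1, h2]
  refine tendsto_nhds_unique (hb.neg.add ha) (hφv.congr fun n => ?_)
  rw [osc_apply, map_add, map_neg]
  rfl

/-- The harmonic oscillator is injective: by definition of the distributional derivative, an
element of its kernel annihilates the dense range of `osc`. -/
theorem H0_injective : Function.Injective H0 := by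
  rw [← LinearMap.ker_eq_bot, LinearMap.ker_eq_bot']
  intro u hu
  have h1 : ∀ ψ : 𝓢(ℝ, ℂ), ∫ x, osc ψ x * (u : L2) x = 0 := by
    intro ψ
    have i : ∀ (w : L2) (χ : 𝓢(ℝ, ℂ)), Integrable fun x => χ x * w x := by
      intro w χ
      refine (integrable_conj_mul (star w) χ).congr ?_
      filter_upwards [Lp.coeFn_star w] with x hx
      rw [hx, Pi.star_apply, RCLike.star_def, Complex.conj_conj, mul_comm]
    have e1 := congrArg (fun T : 𝓢'(ℝ, ℂ) => T ψ) (secondDeriv_spec u)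
    simp only [TemperedDistribution.lineDerivOp_apply_apply, Lp.toTemperedDistribution_apply,
      smul_eq_mul] at e1
    rw [LineDeriv.lineDerivOp_neg, neg_neg, lineDerivOp_eq_D, lineDerivOp_eq_D] at e1
    have e2 : ∫ x, X (X ψ) x * (u : L2) x = ∫ x, ψ x * sqMul u x := by
      refine integral_congr_ae ?_
      filter_upwards [sqMul_coeFn u] with x hx
      rw [hx, X_apply, X_apply]
      push_cast
      ring
    have e3 : ∫ x, osc ψ x * (u : L2) x =
        -(∫ x, D (D ψ) x * (u : L2) x) + ∫ x, X (X ψ) x * (u : L2) x := by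
      rw [neg_add_eq_sub, ← integral_sub (i _ _) (i _ _)]
      congr 1
      ext x
      rw [osc_apply, add_apply, neg_apply]
      ring
    rw [H0_apply, neg_add_eq_zero] at hu
    rw [e3, e1, e2, hu, neg_add_cancel]
  have h2 : star (u : L2) = 0 := by
    refine eq_zero_of_inner_osc_eq_zero _ fun ψ => ?_
    rw [inner_toL2_right, ← h1 ψ]
    refine integral_congr_ae ?_
    filter_upwards [Lp.coeFn_star (u : L2)] with x hx
    rw [hx, Pi.star_apply, RCLike.star_def, Complex.conj_conj, mul_comm]
  refine Subtype.ext ((Lp.eq_zero_iff_ae_eq_zero).mpr ?_)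
  filter_upwards [Lp.coeFn_star (u : L2), (Lp.eq_zero_iff_ae_eq_zero).mp h2] with x hx hx'
  rw [hx, Pi.star_apply] at hx'
  exact star_eq_zero.mp hx'

/-- Schwartz functions form a core of the harmonic oscillator. -/
theorem exists_schwartz_tendsto (u : domain) : ∃ φ : ℕ → 𝓢(ℝ, ℂ),
    Tendsto (fun n => toL2 (φ n)) atTop (𝓝 (u : L2)) ∧
    Tendsto (fun n => toL2 (osc (φ n))) atTop (𝓝 (H0 u)) := by
  obtain ⟨u', hu', φ, h⟩ := exists_H0_eq (H0 u)
  rw [H0_injective hu'] at h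
  exact ⟨φ, h⟩

theorem H0_toL2 (φ : 𝓢(ℝ, ℂ)) : ∃ h : toL2 φ ∈ domain, H0 ⟨toL2 φ, h⟩ = toL2 (osc φ) := by
  obtain ⟨h, h1, h2⟩ := toL2_mem_domain φ
  refine ⟨h, ?_⟩
  rw [H0_apply, h1, h2, osc_apply, map_add, map_neg]

theorem inner_H0_symm (u v : domain) :
    inner ℂ (H0 u) (v : L2) = inner ℂ (u : L2) (H0 v) := by
  obtain ⟨φ, h1, h2⟩ := exists_schwartz_tendsto u
  obtain ⟨ψ, h3, h4⟩ := exists_schwartz_tendsto v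
  exact tendsto_nhds_unique (h2.inner h3)
    ((h1.inner h4).congr fun n => (inner_osc_symm _ _).symm)

theorem norm_sq_le_inner_H0 (u : domain) :
    ‖(u : L2)‖ ^ 2 ≤ (inner ℂ (u : L2) (H0 u)).re := by
  obtain ⟨φ, h1, h2⟩ := exists_schwartz_tendsto u
  refine le_of_tendsto_of_tendsto' (h1.norm.pow 2)
    ((Complex.continuous_re.tendsto _).comp (h1.inner h2)) fun n => ?_
  rw [Function.comp_apply, inner_osc_self, Complex.ofReal_re]
  exact norm_sq_le_form _

/-! ### Bounded skew-adjoint perturbations -/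

theorem bddMul_coeFn (g : ℝ →ᵇ ℝ) (u : L2) :
    bddMul g u =ᵐ[volume] fun x : ℝ => (g x : ℂ) * u x :=
  (memLp_bddMul g u).coeFn_toLp

theorem norm_bddMul_le (g : ℝ →ᵇ ℝ) (u : L2) : ‖bddMul g u‖ ≤ ‖g‖ * ‖u‖ := by
  refine Lp.norm_le_mul_norm_of_ae_le_mul ?_
  filter_upwards [bddMul_coeFn g u] with x hx
  rw [hx, norm_mul, Complex.norm_real]
  gcongr
  exact g.norm_coe_le_norm x

/-- Multiplication by a bounded continuous function, as a bounded operator. -/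
def bddMulCLM (g : ℝ →ᵇ ℝ) : L2 →L[ℂ] L2 := (bddMul g).mkContinuous ‖g‖ (norm_bddMul_le g)

theorem inner_bddMul_symm (g : ℝ →ᵇ ℝ) (u v : L2) :
    inner ℂ (bddMul g u) v = inner ℂ u (bddMul g v) := by
  rw [L2.inner_def, L2.inner_def]
  refine integral_congr_ae ?_
  filter_upwards [bddMul_coeFn g u, bddMul_coeFn g v] with x hx hx'
  rw [hx, hx']
  simp only [RCLike.inner_apply, map_mul, Complex.conj_ofReal]
  ring

theorem re_I_mul_inner_bddMul (g : ℝ →ᵇ ℝ) (u : L2) :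
    (Complex.I * inner ℂ u (bddMul g u)).re = 0 := by
  have h : (starRingEnd ℂ) (inner ℂ u (bddMul g u)) = inner ℂ u (bddMul g u) := by
    rw [inner_conj_symm, inner_bddMul_symm]
  rw [Complex.I_mul_re, Complex.conj_eq_iff_im.mp h, neg_zero]

/-- The operator `-∂ₓ² + x² + i g` with a bounded real potential `g`. -/
def skew (g : ℝ →ᵇ ℝ) : domain →ₗ[ℂ] L2 := H0 + Complex.I • (bddMul g ∘ₗ domain.subtype)

theorem skew_apply (g : ℝ →ᵇ ℝ) (u : domain) :
    skew g u = H0 u + Complex.I • bddMul g u := rfl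

/-- The real part of the numerical range of `-∂ₓ² + x² + i g` is at least `1`. -/
theorem norm_le_norm_skew (g : ℝ →ᵇ ℝ) (u : domain) : ‖(u : L2)‖ ≤ ‖skew g u‖ := by
  refine norm_le_of_norm_sq_le_re_inner ?_
  rw [skew_apply, inner_add_right, inner_smul_right, Complex.add_re, re_I_mul_inner_bddMul,
    add_zero]
  exact norm_sq_le_inner_H0 u

theorem norm_le_norm_H0 (u : domain) : ‖(u : L2)‖ ≤ ‖H0 u‖ :=
  norm_le_of_norm_sq_le_re_inner (norm_sq_le_inner_H0 u)

theorem H0_bijective : Function.Bijective H0 :=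
  ⟨H0_injective, fun v => (exists_H0_eq v).imp fun _ h => h.1⟩

/-- The inverse of the harmonic oscillator, as a linear map onto its domain. -/
def H0inv : L2 →ₗ[ℂ] domain := (LinearEquiv.ofBijective H0 H0_bijective).symm

theorem H0_H0inv (v : L2) : H0 (H0inv v) = v :=
  (LinearEquiv.ofBijective H0 H0_bijective).apply_symm_apply v

/-- The inverse of the harmonic oscillator, as a bounded operator on `L²(ℝ)`. -/
def R0 : L2 →L[ℂ] L2 := (domain.subtype ∘ₗ H0inv).mkContinuous 1 fun v => by
  have := norm_le_norm_H0 (H0inv v)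
  rw [H0_H0inv] at this
  simpa using this

theorem R0_apply (v : L2) : R0 v = H0inv v := rfl

theorem inner_R0_symm (u v : L2) : inner ℂ (R0 u) v = inner ℂ u (R0 v) := by
  have := inner_H0_symm (H0inv u) (H0inv v)
  rw [H0_H0inv, H0_H0inv] at this
  exact this.symm

theorem skew_H0inv (g : ℝ →ᵇ ℝ) (v : L2) :
    skew g (H0inv v) = v + Complex.I • bddMul g (R0 v) := by
  rw [skew_apply, H0_H0inv, R0_apply]

/-- `-∂ₓ² + x² + i g` is a bijection from the domain onto `L²(ℝ)`: writing it as
`(1 + i g H₀⁻¹) H₀`, the bounded factor is bounded below and has a dense range. -/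
theorem skew_surjective (g : ℝ →ᵇ ℝ) : Function.Surjective (skew g) := by
  set S : L2 →L[ℂ] L2 := ContinuousLinearMap.id ℂ L2 + Complex.I • (bddMulCLM g ∘L R0) with hS
  have hS' : ∀ v, S v = skew g (H0inv v) := fun v => (skew_H0inv g v).symm
  have hlow : ∀ v, ‖v‖ ≤ (1 + ‖g‖) * ‖S v‖ := by
    intro v
    have h1 : v = S v - Complex.I • bddMul g (R0 v) := by
      rw [hS', skew_H0inv]
      abel
    have h2 : ‖R0 v‖ ≤ ‖S v‖ := by
      rw [hS']
      exact norm_le_norm_skew g _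
    calc ‖v‖ ≤ ‖S v‖ + ‖Complex.I • bddMul g (R0 v)‖ := by
          nth_rewrite 1 [h1]
          exact norm_sub_le _ _
      _ ≤ ‖S v‖ + ‖g‖ * ‖S v‖ := by
          rw [norm_smul, Complex.norm_I, one_mul]
          gcongr
          exact (norm_bddMul_le g _).trans (by gcongr)
      _ = _ := by ring
  have hanti : AntilipschitzWith (1 + ‖g‖₊) S :=
    AddMonoidHomClass.antilipschitz_of_bound S (by simpa using hlow)
  have hclosed : IsClosed (Set.range S) := hanti.isClosed_range S.uniformContinuous
  have hdense : S.range.topologicalClosure = ⊤ := by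
    rw [Submodule.topologicalClosure_eq_top_iff, Submodule.eq_bot_iff]
    intro v hv
    have h1 : ∀ w, inner ℂ v (S w) = 0 := fun w =>
      (Submodule.mem_orthogonal' _ _).mp hv _ ⟨w, rfl⟩
    have h2 : v - Complex.I • R0 (bddMul g v) = 0 := by
      refine ext_inner_right ℂ fun w => ?_
      rw [inner_zero_left, ← h1 w, hS', skew_H0inv, inner_sub_left, inner_add_right,
        inner_smul_left, inner_smul_right, inner_R0_symm, inner_bddMul_symm, Complex.conj_I]
      ring
    have h3 : skew (-g) (H0inv (Complex.I • bddMul g v)) = 0 := by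
      have h4 : bddMul (-g) v = -bddMul g v := by
        apply Lp.ext
        filter_upwards [bddMul_coeFn (-g) v, bddMul_coeFn g v,
          Lp.coeFn_neg (bddMul g v)] with x e1 e2 e3
        rw [e1, e3, Pi.neg_apply, e2]
        simp
      have h5 : R0 (Complex.I • bddMul g v) = v := by
        rw [map_smul]
        exact (sub_eq_zero.mp h2).symm
      rw [skew_H0inv, h5, h4, smul_neg, add_neg_cancel]
    have h6 := norm_le_norm_skew (-g) (H0inv (Complex.I • bddMul g v))
    rw [h3, norm_zero, norm_le_zero_iff] at h6
    rw [sub_eq_zero.mp h2, ← map_smul]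
    exact h6
  intro v
  have h1 : v ∈ Set.range S := by
    have h2 : v ∈ S.range.topologicalClosure := by
      rw [hdense]
      trivial
    have h3 : v ∈ closure (Set.range S) := h2
    rwa [hclosed.closure_eq] at h3
  obtain ⟨w, rfl⟩ := h1
  exact ⟨H0inv w, (hS' w).symm⟩

/-! ### The resolvent on the imaginary axis -/

/-- The potential `f / ε - l`, written as `ε⁻¹ (f - ε l)`. -/
def shifted (f : ℝ →ᵇ ℝ) (ε l : ℝ) : ℝ →ᵇ ℝ :=
  ε⁻¹ • (f - BoundedContinuousFunction.const ℝ (ε * l))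

theorem bddMul_smul (a : ℝ) (g : ℝ →ᵇ ℝ) (u : L2) :
    bddMul (a • g) u = (a : ℂ) • bddMul g u := by
  apply Lp.ext
  filter_upwards [bddMul_coeFn (a • g) u, bddMul_coeFn g u,
    Lp.coeFn_smul (a : ℂ) (bddMul g u)] with x h1 h2 h3
  rw [h1, h3, Pi.smul_apply, h2, BoundedContinuousFunction.coe_smul]
  simp only [smul_eq_mul]
  push_cast
  ring

theorem bddMul_sub_const (g : ℝ →ᵇ ℝ) (c : ℝ) (u : L2) :
    bddMul (g - BoundedContinuousFunction.const ℝ c) u = bddMul g u - (c : ℂ) • u := by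
  apply Lp.ext
  filter_upwards [bddMul_coeFn (g - BoundedContinuousFunction.const ℝ c) u, bddMul_coeFn g u,
    Lp.coeFn_smul (c : ℂ) u, Lp.coeFn_sub (bddMul g u) ((c : ℂ) • u)] with x h1 h2 h3 h4
  rw [h1, h4, Pi.sub_apply, h2, h3, Pi.smul_apply, smul_eq_mul,
    BoundedContinuousFunction.coe_sub, Pi.sub_apply, BoundedContinuousFunction.const_apply]
  push_cast
  ring

/-- The identity `H_ε - i l = -∂ₓ² + x² + i (f / ε - l)`, with the defining formula of `H_ε` on its
domain written out. -/
theorem H_sub_smul (f : ℝ →ᵇ ℝ) {ε : ℝ} (hε : 0 < ε) (l : ℝ) (u : domain) :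
    (-secondDeriv + sqMul + (Complex.I / (ε : ℂ)) • (bddMul f ∘ₗ domain.subtype)) u -
      (Complex.I * (l : ℂ)) • (u : L2) = skew (shifted f ε l) u := by
  have hε' : (ε : ℂ) ≠ 0 := by exact_mod_cast hε.ne'
  rw [skew_apply, shifted, bddMul_smul, bddMul_sub_const, LinearMap.add_apply,
    LinearMap.smul_apply, smul_sub, smul_sub, smul_smul, smul_smul, smul_smul, add_sub_assoc]
  congr 1
  congr 2
  · push_cast
    rw [div_eq_mul_inv]
  · push_cast
    field_simp

theorem exists_isResolventAt (f : ℝ →ᵇ ℝ) {ε : ℝ} (hε : 0 < ε) (l : ℝ) :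
    ∃ R : L2 →L[ℂ] L2, IsResolventAt (H f ε) (Complex.I * l) R := by
  set g := shifted f ε l
  have hinj : Function.Injective (skew g) := by
    rw [← LinearMap.ker_eq_bot, LinearMap.ker_eq_bot']
    intro u hu
    have := norm_le_norm_skew g u
    rw [hu, norm_zero, norm_le_zero_iff] at this
    exact Subtype.ext this
  set e := LinearEquiv.ofBijective (skew g) ⟨hinj, skew_surjective g⟩ with he
  have he1 : ∀ v, skew g (e.symm v) = v := fun v => e.apply_symm_apply v
  refine ⟨(domain.subtype ∘ₗ e.symm.toLinearMap).mkContinuous 1 fun v => ?_, fun v => ?_,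
    fun u => ?_⟩
  · have := norm_le_norm_skew g (e.symm v)
    rw [he1] at this
    simpa using this
  · exact ⟨(e.symm v).2, (H_sub_smul f hε l (e.symm v)).trans (he1 v)⟩
  · have h1 : (H f ε) u - (Complex.I * (l : ℂ)) • (u : L2) = skew g u := H_sub_smul f hε l u
    rw [h1]
    exact congrArg Subtype.val (e.symm_apply_apply u)

theorem resolventNorm_eq {A : L2 →ₗ.[ℂ] L2} {z : ℂ} {R : L2 →L[ℂ] L2}
    (hR : IsResolventAt A z R) : resolventNorm A z = ‖R‖ₑ := by
  refine le_antisymm (iInf₂_le R hR) (le_iInf₂ fun S hS => ?_)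
  rw [hR.unique hS]

theorem resolventNorm_le (f : ℝ →ᵇ ℝ) {ε : ℝ} (hε : 0 < ε) (l : ℝ) {M : ℝ≥0} (hM : 0 < M)
    (h : ∀ u : domain, M * ‖(u : L2)‖ ≤ ‖skew (shifted f ε l) u‖) :
    resolventNorm (H f ε) (Complex.I * l) ≤ (M : ℝ≥0∞)⁻¹ := by
  obtain ⟨R, hR⟩ := exists_isResolventAt f hε l
  rw [resolventNorm_eq hR, ← ENNReal.coe_inv hM.ne', enorm_eq_nnnorm, ENNReal.coe_le_coe]
  refine R.opNNNorm_le_bound _ fun v => ?_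
  obtain ⟨hv, hv'⟩ := hR.1 v
  have h1 := h ⟨R v, hv⟩
  rw [← H_sub_smul f hε l ⟨R v, hv⟩] at h1
  have h2 : (M : ℝ) * ‖R v‖ ≤ ‖v‖ := h1.trans_eq (congrArg norm hv')
  rw [← NNReal.coe_le_coe, NNReal.coe_mul, NNReal.coe_inv, coe_nnnorm, coe_nnnorm,
    ← div_eq_inv_mul, le_div_iff₀ (by exact_mod_cast hM)]
  linarith

theorem enorm_le_resolventNorm_mul (f : ℝ →ᵇ ℝ) {ε : ℝ} (hε : 0 < ε) (l : ℝ) (u : domain) :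
    ‖(u : L2)‖ₑ ≤ resolventNorm (H f ε) (Complex.I * l) * ‖skew (shifted f ε l) u‖ₑ := by
  obtain ⟨R, hR⟩ := exists_isResolventAt f hε l
  have h1 : R ((H f ε) u - (Complex.I * (l : ℂ)) • (u : L2)) = u := hR.2 u
  have h2 : (H f ε) u - (Complex.I * (l : ℂ)) • (u : L2) = skew (shifted f ε l) u :=
    H_sub_smul f hε l u
  rw [h2] at h1
  rw [resolventNorm_eq hR]
  calc ‖(u : L2)‖ₑ = ‖R (skew (shifted f ε l) u)‖ₑ := by rw [h1]
    _ ≤ _ := R.le_opENorm _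

theorem le_Psi (f : ℝ →ᵇ ℝ) {ε : ℝ} (hε : 0 < ε) {M : ℝ≥0} (hM : 0 < M)
    (h : ∀ (l : ℝ) (u : domain), M * ‖(u : L2)‖ ≤ ‖skew (shifted f ε l) u‖) :
    (M : ℝ≥0∞) ≤ Psi f ε := by
  rw [Psi, ENNReal.le_inv_iff_le_inv]
  exact iSup_le fun l => resolventNorm_le f hε l hM (h l)

/-- Any single `u` in the domain and any `l` bound `Ψ(ε)` by `‖(H_ε - i l) u‖ / ‖u‖`. -/
theorem Psi_le (f : ℝ →ᵇ ℝ) {ε : ℝ} (hε : 0 < ε) (l : ℝ) {u : domain} (hu : u ≠ 0) :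
    Psi f ε ≤ (‖skew (shifted f ε l) u‖₊ / ‖(u : L2)‖₊ : ℝ≥0) := by
  have h0 : ‖(u : L2)‖₊ ≠ 0 := by simpa using hu
  have h1 := enorm_le_resolventNorm_mul f hε l u
  rw [Psi, ENNReal.inv_le_iff_inv_le, ENNReal.coe_div h0, ENNReal.inv_div]
  · refine (ENNReal.div_le_of_le_mul ?_).trans
      (le_iSup (fun l : ℝ => resolventNorm (H f ε) (Complex.I * (l : ℂ))) l)
    exact h1
  · exact Or.inl ENNReal.coe_ne_top
  · right
    have h2 := norm_le_norm_skew (shifted f ε l) u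
    have h3 : 0 < ‖(u : L2)‖ := by simpa using hu
    rw [ENNReal.coe_ne_zero, ← NNReal.coe_ne_zero]
    exact (h3.trans_le h2).ne'

theorem toL2_ne_zero {φ : 𝓢(ℝ, ℂ)} {x : ℝ} (h : φ x ≠ 0) : toL2 φ ≠ 0 := by
  intro h0
  have h1 : φ = 0 := SchwartzMap.injective_toLp 2 volume (h0.trans (map_zero toL2).symm)
  exact h (by rw [h1]; rfl)

theorem Psi_pos (f : ℝ →ᵇ ℝ) {ε : ℝ} (hε : 0 < ε) : 0 < Psi f ε := by
  refine lt_of_lt_of_le ?_ (le_Psi f hε one_pos fun l u => ?_)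
  · exact zero_lt_one
  · rw [NNReal.coe_one, one_mul]
    exact norm_le_norm_skew _ u

theorem Psi_lt_top (f : ℝ →ᵇ ℝ) {ε : ℝ} (hε : 0 < ε) : Psi f ε < ∞ := by
  obtain ⟨h, -⟩ := H0_toL2 gaussian
  have hne : (⟨toL2 gaussian, h⟩ : domain) ≠ 0 := fun h0 =>
    toL2_ne_zero (x := 0) (by rw [gaussian_apply]; exact Complex.exp_ne_zero _)
      (congrArg Subtype.val h0)
  exact (Psi_le f hε 0 hne).trans_lt ENNReal.coe_lt_top

/-! ### Level sets with interior -/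

theorem exists_bump (x₀ : ℝ) {r : ℝ} (hr : 0 < r) : ∃ χ : 𝓢(ℝ, ℂ), ∃ b : ℝ → ℝ,
    (∀ x, χ x = b x) ∧ (∀ x, 0 ≤ b x) ∧ b x₀ = 1 ∧ ∀ x, b x ≠ 0 → |x - x₀| < r := by
  let b : ContDiffBump x₀ := ⟨r / 2, r, by positivity, by linarith⟩
  have h1 : HasCompactSupport (Complex.ofRealCLM ∘ b) := b.hasCompactSupport.comp_left rfl
  have h2 : ContDiff ℝ (⊤ : ℕ∞) (Complex.ofRealCLM ∘ b) :=
    Complex.ofRealCLM.contDiff.comp b.contDiff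
  refine ⟨h1.toSchwartzMap h2, b, fun x => rfl, fun x => b.nonneg,
    b.one_of_mem_closedBall (by simp; positivity), fun x hx => ?_⟩
  have : x ∈ Function.support b := hx
  rw [b.support_eq, Metric.mem_ball, Real.dist_eq] at this
  exact this

/-- If `f = c` on an interval, then a bump function supported there does not see the potential
`(f - c) / ε`, so that it bounds `Ψ(ε)` uniformly in `ε`. -/
theorem exists_Psi_le (f : ℝ →ᵇ ℝ) {c : ℝ} (h : (interior {x : ℝ | f x = c}).Nonempty) :
    ∃ C : ℝ≥0, ∀ ε : ℝ, 0 < ε → Psi f ε ≤ C := by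
  obtain ⟨x₀, hx₀⟩ := h
  obtain ⟨r, hr, hball⟩ := Metric.isOpen_iff.mp isOpen_interior x₀ hx₀
  obtain ⟨χ, b, hχ, -, hb1, hb⟩ := exists_bump x₀ hr
  obtain ⟨hmem, hH0⟩ := H0_toL2 χ
  have hne : (⟨toL2 χ, hmem⟩ : domain) ≠ 0 := fun h0 =>
    toL2_ne_zero (x := x₀) (by rw [hχ, hb1]; simp) (congrArg Subtype.val h0)
  refine ⟨‖toL2 (osc χ)‖₊ / ‖toL2 χ‖₊, fun ε hε => ?_⟩
  have hzero : bddMul (shifted f ε (c / ε)) (toL2 χ) = 0 := by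
    rw [Lp.eq_zero_iff_ae_eq_zero]
    filter_upwards [bddMul_coeFn (shifted f ε (c / ε)) (toL2 χ), toL2_coeFn χ] with x h1 h2
    rw [h1, h2, hχ]
    by_cases hx : b x = 0
    · simp [hx]
    · have h3 : f x = c := by
        have h4 : x ∈ Metric.ball x₀ r := by
          rw [Metric.mem_ball, Real.dist_eq]
          exact hb x hx
        exact (interior_subset (hball h4) : x ∈ {x : ℝ | f x = c})
      have h5 : shifted f ε (c / ε) x = 0 := by
        have : shifted f ε (c / ε) x = ε⁻¹ * (f x - ε * (c / ε)) := rfl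
        rw [this, h3, mul_div_cancel₀ _ hε.ne', sub_self, mul_zero]
      rw [h5]
      simp
  have h6 := Psi_le f hε (c / ε) hne
  rwa [skew_apply, hH0, hzero, smul_zero, add_zero] at h6

/-! ### Pointwise estimates for Schwartz functions -/

theorem norm_toL2_sq (φ : 𝓢(ℝ, ℂ)) : ‖toL2 φ‖ ^ 2 = ∫ x, ‖φ x‖ ^ 2 := by
  have h1 := inner_toL2 φ φ
  rw [inner_self_eq_norm_sq_to_K] at h1
  simp only [inner_self_eq_norm_sq_to_K] at h1
  have h2 : ∫ x, ((‖φ x‖ : ℂ)) ^ 2 = ((∫ x, ‖φ x‖ ^ 2 : ℝ) : ℂ) := by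
    rw [← integral_complex_ofReal]
    simp
  have h3 : ((‖toL2 φ‖ ^ 2 : ℝ) : ℂ) = ((∫ x, ‖φ x‖ ^ 2 : ℝ) : ℂ) := by
    rw [← h2]
    push_cast
    exact h1
  exact_mod_cast h3

theorem integrable_norm_sq (φ : 𝓢(ℝ, ℂ)) : Integrable fun x => ‖φ x‖ ^ 2 :=
  (φ.memLp 2 volume).integrable_norm_pow two_ne_zero

/-- Hölder continuity of exponent `1/2` of functions with derivative in `L²`. -/
theorem norm_sub_le_sqrt (φ : 𝓢(ℝ, ℂ)) (x y : ℝ) :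
    ‖φ y - φ x‖ ≤ √|y - x| * ‖toL2 (D φ)‖ := by
  wlog hxy : x ≤ y generalizing x y
  · rw [norm_sub_rev, abs_sub_comm]
    exact this y x (le_of_not_ge hxy)
  have h1 : ∫ t in x..y, D φ t = φ y - φ x :=
    intervalIntegral.integral_eq_sub_of_hasDerivAt (fun t _ => φ.hasDerivAt t)
      ((D φ).continuous.intervalIntegrable x y)
  have hfin : volume (Set.Ioc x y) ≠ ∞ := by simp
  have h2 : inner ℂ (indicatorConstLp 2 measurableSet_Ioc hfin (1 : ℂ)) (toL2 (D φ)) =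
      φ y - φ x := by
    rw [L2.inner_indicatorConstLp_one, ← h1, intervalIntegral.integral_of_le hxy]
    exact integral_congr_ae (ae_restrict_of_ae (toL2_coeFn (D φ)))
  rw [← h2]
  refine (norm_inner_le_norm _ _).trans (le_of_eq ?_)
  rw [norm_indicatorConstLp two_ne_zero ENNReal.ofNat_ne_top, abs_of_nonneg (by linarith),
    Real.sqrt_eq_rpow]
  simp [Measure.real, hxy]

/-- A normalized function with small second moment is not small everywhere on `[-r, r]`. -/
theorem exists_le_norm_sq {φ : 𝓢(ℝ, ℂ)} {M r : ℝ} (hr : 0 < r) (hM : 2 * M ≤ r ^ 2)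
    (h1 : ‖toL2 φ‖ = 1) (h2 : ‖toL2 (X φ)‖ ^ 2 ≤ M) :
    ∃ x ∈ Set.Icc (-r) r, 1 / (8 * r) ≤ ‖φ x‖ ^ 2 := by
  -- Otherwise `|φ|² ≤ 1 / (8 r)` on `[-r, r]` and `|φ|² ≤ x² |φ|² / r²` outside, and the total mass
  -- is at most `1 / 4 + 1 / 2`.
  by_contra! hcon
  have hi : Integrable ((Set.Icc (-r) r).indicator fun _ : ℝ => 1 / (8 * r)) :=
    (integrable_indicator_iff measurableSet_Icc).mpr (integrableOn_const (by simp))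
  have hj : Integrable fun x => (r ^ 2)⁻¹ * ‖X φ x‖ ^ 2 := (integrable_norm_sq (X φ)).const_mul _
  have hle : ∫ x, ‖φ x‖ ^ 2 ≤ ∫ x, ((Set.Icc (-r) r).indicator (fun _ : ℝ => 1 / (8 * r)) x +
      (r ^ 2)⁻¹ * ‖X φ x‖ ^ 2) := by
    refine integral_mono (integrable_norm_sq φ) (hi.add hj) fun x => ?_
    by_cases hx : x ∈ Set.Icc (-r) r
    · simp only [Set.indicator_of_mem hx]
      have := hcon x hx
      have h3 : 0 ≤ (r ^ 2)⁻¹ * ‖X φ x‖ ^ 2 := by positivity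
      linarith
    · simp only [Set.indicator_of_notMem hx, zero_add, X_apply, norm_mul, Complex.norm_real,
        Real.norm_eq_abs, mul_pow, sq_abs]
      have h3 : r ^ 2 ≤ x ^ 2 := by
        rw [Set.mem_Icc, ← abs_le] at hx
        rw [← sq_abs x]
        exact pow_le_pow_left₀ hr.le (le_of_not_ge hx) 2
      rw [← mul_assoc]
      refine le_mul_of_one_le_left (by positivity) ?_
      rw [inv_mul_eq_div, one_le_div (by positivity)]
      exact h3
  rw [integral_add hi hj, integral_indicator measurableSet_Icc, setIntegral_const,
    integral_const_mul, ← norm_toL2_sq, ← norm_toL2_sq, h1, Real.volume_real_Icc_of_le (by linarith),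
    smul_eq_mul] at hle
  have h3 : (r - -r) * (1 / (8 * r)) = 1 / 4 := by
    field_simp
    ring
  have h4 : (r ^ 2)⁻¹ * ‖toL2 (X φ)‖ ^ 2 ≤ 1 / 2 := by
    rw [inv_mul_le_iff₀ (by positivity)]
    linarith
  rw [h3] at hle
  linarith

/-! ### Level sets without interior -/

/-- The operator `-∂ₓ² + x² + i g` on Schwartz functions. -/
def skewSchwartz (g : ℝ →ᵇ ℝ) : 𝓢(ℝ, ℂ) →L[ℂ] L2 :=
  toL2 ∘L osc + Complex.I • (bddMulCLM g ∘L toL2)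

theorem skewSchwartz_apply (g : ℝ →ᵇ ℝ) (φ : 𝓢(ℝ, ℂ)) :
    skewSchwartz g φ = toL2 (osc φ) + Complex.I • bddMul g (toL2 φ) := rfl

/-- A lower bound on Schwartz functions extends to the whole domain, because Schwartz functions
form a core. -/
theorem le_norm_skew {g : ℝ →ᵇ ℝ} {M : ℝ} (h : ∀ φ, M * ‖toL2 φ‖ ≤ ‖skewSchwartz g φ‖)
    (u : domain) : M * ‖(u : L2)‖ ≤ ‖skew g u‖ := by
  obtain ⟨φ, h1, h2⟩ := exists_schwartz_tendsto u
  have h3 : Tendsto (fun n => skewSchwartz g (φ n)) atTop (𝓝 (skew g u)) :=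
    h2.add ((((bddMulCLM g).continuous.tendsto _).comp h1).const_smul Complex.I)
  exact le_of_tendsto_of_tendsto' (h1.norm.const_mul M) h3.norm fun n => h (φ n)

section Normalized

variable {φ : 𝓢(ℝ, ℂ)} {M : ℝ}

theorem form_le_of_norm_skewSchwartz_le {g : ℝ →ᵇ ℝ} (h1 : ‖toL2 φ‖ = 1)
    (h2 : ‖skewSchwartz g φ‖ ≤ M) : ‖toL2 (D φ)‖ ^ 2 + ‖toL2 (X φ)‖ ^ 2 ≤ M := by
  have h3 : (inner ℂ (toL2 φ) (skewSchwartz g φ)).re =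
      ‖toL2 (D φ)‖ ^ 2 + ‖toL2 (X φ)‖ ^ 2 := by
    rw [skewSchwartz_apply, inner_add_right, inner_smul_right, Complex.add_re,
      re_I_mul_inner_bddMul, inner_osc_self, Complex.ofReal_re, add_zero]
  have h4 : (inner ℂ (toL2 φ) (skewSchwartz g φ)).re ≤ ‖toL2 φ‖ * ‖skewSchwartz g φ‖ :=
    re_inner_le_norm (𝕜 := ℂ) _ _
  rw [h3, h1, one_mul] at h4
  exact h4.trans h2

/-- Tested against a fixed Schwartz function, the potential term is of order `ε`, because the
harmonic oscillator can be moved to the test function. -/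
theorem norm_inner_bddMul_le {f : ℝ →ᵇ ℝ} {ε l : ℝ} (hε : 0 < ε) (h1 : ‖toL2 φ‖ = 1)
    (h2 : ‖skewSchwartz (shifted f ε l) φ‖ ≤ M) (χ : 𝓢(ℝ, ℂ)) :
    ‖inner ℂ (toL2 χ) (bddMul (f - BoundedContinuousFunction.const ℝ (ε * l)) (toL2 φ))‖ ≤
      ε * (‖toL2 χ‖ * M + ‖toL2 (osc χ)‖) := by
  set p := inner ℂ (toL2 χ) (bddMul (f - BoundedContinuousFunction.const ℝ (ε * l)) (toL2 φ))
    with hp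
  have hε' : (ε : ℂ) ≠ 0 := by exact_mod_cast hε.ne'
  have h3 : inner ℂ (toL2 χ) (skewSchwartz (shifted f ε l) φ) =
      inner ℂ (toL2 (osc χ)) (toL2 φ) + Complex.I * ((ε : ℂ)⁻¹ * p) := by
    rw [skewSchwartz_apply, shifted, bddMul_smul, inner_add_right, inner_smul_right,
      inner_smul_right, inner_osc_symm]
    push_cast
    rfl
  have h4 : p = -Complex.I * (ε * (inner ℂ (toL2 χ) (skewSchwartz (shifted f ε l) φ) -
      inner ℂ (toL2 (osc χ)) (toL2 φ))) := by
    rw [h3, add_sub_cancel_left]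
    field_simp
    rw [Complex.I_sq]
    ring
  rw [h4, norm_mul, norm_mul, norm_neg, Complex.norm_I, one_mul, Complex.norm_real,
    Real.norm_of_nonneg hε.le]
  refine mul_le_mul_of_nonneg_left ((norm_sub_le _ _).trans (add_le_add ?_ ?_)) hε.le
  · exact (norm_inner_le_norm _ _).trans (mul_le_mul_of_nonneg_left h2 (norm_nonneg _))
  · exact (norm_inner_le_norm _ _).trans_eq (by rw [h1, mul_one])

/-- The spectral parameter of a quasimode is comparable to the values of `f`. -/
theorem abs_mul_le_of_norm_skewSchwartz_le {f : ℝ →ᵇ ℝ} {ε l : ℝ} (hε : 0 < ε)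
    (h1 : ‖toL2 φ‖ = 1) (h2 : ‖skewSchwartz (shifted f ε l) φ‖ ≤ M) :
    |ε * l| ≤ ‖f‖ + ε * M := by
  set q := inner ℂ (toL2 φ) (bddMul (shifted f ε l) (toL2 φ)) with hq
  have h4 : (inner ℂ (toL2 φ) (skewSchwartz (shifted f ε l) φ)).im = q.re := by
    rw [skewSchwartz_apply, inner_add_right, inner_smul_right, Complex.add_im, inner_osc_self,
      Complex.ofReal_im, Complex.I_mul_im, zero_add]
  have h5 : |q.re| ≤ M := by
    rw [← h4]
    refine (Complex.abs_im_le_norm _).trans ((norm_inner_le_norm _ _).trans ?_)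
    rw [h1, one_mul]
    exact h2
  have h6 : q.re = ε⁻¹ * ((inner ℂ (toL2 φ) (bddMul f (toL2 φ))).re - ε * l) := by
    rw [hq, shifted, bddMul_smul, bddMul_sub_const, inner_smul_right, inner_sub_right,
      inner_smul_right, inner_self_eq_norm_sq_to_K, h1, Complex.re_ofReal_mul, Complex.sub_re]
    simp
  have h7 : |(inner ℂ (toL2 φ) (bddMul f (toL2 φ))).re| ≤ ‖f‖ := by
    refine (Complex.abs_re_le_norm _).trans ((norm_inner_le_norm _ _).trans ?_)
    have := norm_bddMul_le f (toL2 φ)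
    rw [h1, mul_one] at this
    rwa [h1, one_mul]
  have h8 : ε * l = (inner ℂ (toL2 φ) (bddMul f (toL2 φ))).re - ε * q.re := by
    rw [h6]
    field_simp
    ring
  rw [h8]
  refine (abs_sub _ _).trans (add_le_add h7 ?_)
  rw [abs_mul, abs_of_pos hε]
  gcongr

end Normalized

theorem integrable_of_ofReal_eq {χ : 𝓢(ℝ, ℂ)} {b : ℝ → ℝ} (hχ : ∀ x, χ x = b x) :
    Integrable b := by
  refine (χ.integrable (μ := volume)).re.congr (Eventually.of_forall fun x => ?_)
  change (χ x).re = b x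
  rw [hχ, Complex.ofReal_re]

/-- If `h φ` stays in a half plane away from zero on the support of a nonnegative function `b`,
then its integral against `b` cannot be small. -/
theorem mul_integral_le_norm_inner {χ φ : 𝓢(ℝ, ℂ)} {b : ℝ → ℝ} (hχ : ∀ x, χ x = b x)
    (hb : ∀ x, 0 ≤ b x) (h : ℝ →ᵇ ℝ) {θ : ℂ} (hθ : ‖θ‖ ≤ 1) {K : ℝ}
    (hK : ∀ x, b x ≠ 0 → K ≤ (θ * (h x * φ x)).re) :
    K * ∫ x, b x ≤ ‖inner ℂ (toL2 χ) (bddMul h (toL2 φ))‖ := by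
  have hae : (fun x => inner ℂ (toL2 χ x) (bddMul h (toL2 φ) x)) =ᵐ[volume]
      fun x => (b x : ℂ) * (h x * φ x) := by
    filter_upwards [toL2_coeFn χ, toL2_coeFn φ, bddMul_coeFn h (toL2 φ)] with x h1 h2 h3
    rw [h1, h3, h2, hχ, RCLike.inner_apply, Complex.conj_ofReal, mul_comm]
  have hint : Integrable fun x => (b x : ℂ) * (h x * φ x) :=
    (L2.integrable_inner (𝕜 := ℂ) (toL2 χ) (bddMul h (toL2 φ))).congr hae
  have hbint : Integrable b := integrable_of_ofReal_eq hχ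
  have e1 : inner ℂ (toL2 χ) (bddMul h (toL2 φ)) = ∫ x, (b x : ℂ) * (h x * φ x) := by
    rw [L2.inner_def]
    exact integral_congr_ae hae
  have e2 : K * ∫ x, b x ≤ (θ * ∫ x, (b x : ℂ) * (h x * φ x)).re := by
    have e3 : (∫ x, θ * ((b x : ℂ) * (h x * φ x))).re =
        ∫ x, (θ * ((b x : ℂ) * (h x * φ x))).re :=
      (integral_re (𝕜 := ℂ) (hint.const_mul θ)).symm
    rw [← integral_const_mul, ← integral_const_mul, e3]
    refine integral_mono (hbint.const_mul K) (hint.const_mul θ).re fun x => ?_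
    change K * b x ≤ (θ * ((b x : ℂ) * (h x * φ x))).re
    rw [show θ * ((b x : ℂ) * (h x * φ x)) = b x * (θ * (h x * φ x)) by ring,
      Complex.re_ofReal_mul, mul_comm]
    by_cases hx : b x = 0
    · simp [hx]
    · exact mul_le_mul_of_nonneg_left (hK x hx) (hb x)
  rw [e1]
  refine e2.trans ((Complex.re_le_norm _).trans ?_)
  rw [norm_mul]
  exact mul_le_of_le_one_left (norm_nonneg _) hθ

/-- A complex number of modulus one rotating `z` to the positive axis keeps nearby numbers in a
half plane. -/
theorem exists_rotation {z : ℂ} (hz : z ≠ 0) : ∃ θ : ℂ, ‖θ‖ = 1 ∧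
    ∀ w : ℂ, ‖z‖ - ‖w - z‖ ≤ (θ * w).re := by
  have hz' : (‖z‖ : ℂ) ≠ 0 := by simpa using hz
  set θ := (starRingEnd ℂ) z / (‖z‖ : ℂ) with hθ
  have h1 : ‖θ‖ = 1 := by
    rw [hθ, norm_div, RCLike.norm_conj, Complex.norm_real, norm_norm,
      div_self (by simpa using hz)]
  refine ⟨θ, h1, fun w => ?_⟩
  have h2 : θ * z = ‖z‖ := by
    rw [hθ, div_mul_eq_mul_div, mul_comm, Complex.mul_conj, Complex.normSq_eq_norm_sq]
    push_cast
    field_simp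
  have h3 : θ * w = ‖z‖ + θ * (w - z) := by
    rw [← h2]
    ring
  have h4 : -‖w - z‖ ≤ (θ * (w - z)).re := by
    have := (abs_le.mp (Complex.abs_re_le_norm (θ * (w - z)))).1
    rwa [norm_mul, h1, one_mul] at this
  rw [h3, Complex.add_re, Complex.ofReal_re]
  linarith

/-- If no level set of `f` has interior, then there are no normalized quasimodes
`‖(H_ε - i l) φ‖ ≤ M` with `ε → 0`. -/
theorem not_exists_quasimodes (f : ℝ →ᵇ ℝ) (hf : ∀ c : ℝ, interior {x : ℝ | f x = c} = ∅)
    {M : ℝ} (hM : 0 < M) {ε l : ℕ → ℝ} {φ : ℕ → 𝓢(ℝ, ℂ)} (hε : ∀ n, 0 < ε n)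
    (hε0 : Tendsto ε atTop (𝓝 0)) (hε1 : ∀ n, ε n ≤ 1) (hφ : ∀ n, ‖toL2 (φ n)‖ = 1) :
    ¬ ∀ n, ‖skewSchwartz (shifted f (ε n) (l n)) (φ n)‖ ≤ M := by
  intro hle
  have hform := fun n => form_le_of_norm_skewSchwartz_le (hφ n) (hle n)
  -- The second moments are at most `M`, so half of the mass lies in `[-r, r]` with `r² = 2 M`,
  -- where each function has a value of modulus at least `δ`.
  set r := √(2 * M) with hr
  have hr0 : 0 < r := Real.sqrt_pos.mpr (by positivity)
  have hpt : ∀ n, ∃ x ∈ Set.Icc (-r) r, 1 / (8 * r) ≤ ‖φ n x‖ ^ 2 := fun n =>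
    exists_le_norm_sq hr0 (Real.sq_sqrt (by positivity)).ge (hφ n)
      (by linarith [hform n, sq_nonneg ‖toL2 (D (φ n))‖])
  choose x hx hxφ using hpt
  set δ := √(1 / (8 * r)) with hδ
  have hδ0 : 0 < δ := Real.sqrt_pos.mpr (by positivity)
  have hxδ : ∀ n, δ ≤ ‖φ n (x n)‖ := fun n => Real.sqrt_le_left (norm_nonneg _) |>.mpr (hxφ n)
  have hD : ∀ n, ‖toL2 (D (φ n))‖ ≤ √M := fun n =>
    Real.le_sqrt_of_sq_le (by linarith [hform n, sq_nonneg ‖toL2 (X (φ n))‖])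
  have hcb : ∀ n, ε n * l n ∈ Set.Icc (-(‖f‖ + M)) (‖f‖ + M) := fun n => by
    rw [Set.mem_Icc, ← abs_le]
    refine (abs_mul_le_of_norm_skewSchwartz_le (hε n) (hφ n) (hle n)).trans ?_
    nlinarith [hε1 n]
  obtain ⟨⟨x₀, c⟩, -, k, hk, hlim⟩ := (isCompact_Icc.prod isCompact_Icc).tendsto_subseq
    fun n => (⟨hx n, hcb n⟩ : (x n, ε n * l n) ∈
      Set.Icc (-r) r ×ˢ Set.Icc (-(‖f‖ + M)) (‖f‖ + M))
  have hxlim : Tendsto (fun n => x (k n)) atTop (𝓝 x₀) := (continuous_fst.tendsto _).comp hlim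
  have hclim : Tendsto (fun n => ε (k n) * l (k n)) atTop (𝓝 c) :=
    (continuous_snd.tendsto _).comp hlim
  -- The functions `φ n` oscillate by at most `δ / 2` on an interval of radius `η` around `x₀`.
  set η := δ ^ 2 / (8 * M) with hη
  have hη0 : 0 < η := by positivity
  obtain ⟨y, hy, hfy⟩ : ∃ y ∈ Metric.ball x₀ η, f y ≠ c := by
    by_contra! hcon
    have h1 : Metric.ball x₀ η ⊆ interior {x : ℝ | f x = c} :=
      interior_maximal hcon Metric.isOpen_ball
    rw [hf c] at h1
    exact h1 (Metric.mem_ball_self hη0)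
  rw [Metric.mem_ball, Real.dist_eq] at hy
  set d := f y - c with hd
  have hd0 : 0 < |d| := abs_pos.mpr (sub_ne_zero.mpr hfy)
  obtain ⟨r₁, hr₁, hcont⟩ := Metric.continuous_iff.mp f.continuous y (|d| / 4) (by positivity)
  obtain ⟨χ, b, hχ, hb0, hb1, hb⟩ := exists_bump y
    (lt_min hr₁ (sub_pos.mpr hy) : 0 < min r₁ (η - |y - x₀|))
  have hbpos : 0 < ∫ t, b t := by
    have hbc : Continuous b := by
      have : b = fun t => (χ t).re := by
        ext t
        rw [hχ, Complex.ofReal_re]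
      rw [this]
      exact Complex.continuous_re.comp χ.continuous
    exact integral_pos_of_integrable_nonneg_nonzero (x := y) hbc (integrable_of_ofReal_eq hχ) hb0
      (by simp [hb1])
  have hlow : ∀ᶠ n in atTop, (|d| / 2 * (δ / 2)) * ∫ t, b t ≤
      ε (k n) * (‖toL2 χ‖ * M + ‖toL2 (osc χ)‖) := by
    have ev1 := Metric.tendsto_nhds.mp hxlim η hη0
    have ev2 := Metric.tendsto_nhds.mp hclim (|d| / 4) (by positivity)
    filter_upwards [ev1, ev2] with n hn1 hn2
    rw [Real.dist_eq] at hn1 hn2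
    refine le_trans ?_ (norm_inner_bddMul_le (hε (k n)) (hφ (k n)) (hle (k n)) χ)
    -- Rotating `φ` by `θ` and fixing the sign of `f - c` by the sign of `d` makes the integrand
    -- at least `(|d| / 2) (δ / 2)` on the support of the bump function.
    have hz : φ (k n) (x (k n)) ≠ 0 := fun h0 => by
      have := hxδ (k n)
      rw [h0, norm_zero] at this
      linarith
    obtain ⟨θ, hθ1, hθ⟩ := exists_rotation hz
    have hsign : ‖(SignType.sign d : ℝ)‖ ≤ 1 := by
      rcases lt_trichotomy d 0 with h | h | h <;> simp [h]
    refine mul_integral_le_norm_inner hχ hb0 _ (θ := ((SignType.sign d : ℝ) : ℂ) * θ) ?_ ?_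
    · rw [norm_mul, hθ1, mul_one, Complex.norm_real]
      exact hsign
    · intro t ht
      have ht' := hb t ht
      rw [lt_min_iff] at ht'
      have h1 : |d| / 2 ≤ (SignType.sign d : ℝ) * (f t - ε (k n) * l (k n)) := by
        have e1 := hcont t (by rw [Real.dist_eq]; exact ht'.1)
        rw [Real.dist_eq] at e1
        have e2 : (SignType.sign d : ℝ) * (f t - ε (k n) * l (k n)) =
            |d| + (SignType.sign d : ℝ) * ((f t - f y) - (ε (k n) * l (k n) - c)) := by
          rw [← sign_mul_self d, hd]
          ring
        have e3 : |(SignType.sign d : ℝ) * ((f t - f y) - (ε (k n) * l (k n) - c))| ≤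
            |d| / 2 := by
          rw [abs_mul]
          refine (mul_le_of_le_one_left (abs_nonneg _) hsign).trans ((abs_sub _ _).trans ?_)
          linarith
        linarith [neg_abs_le ((SignType.sign d : ℝ) * ((f t - f y) - (ε (k n) * l (k n) - c)))]
      have h2 : δ / 2 ≤ (θ * φ (k n) t).re := by
        refine le_trans ?_ (hθ _)
        have e1 : |t - x (k n)| ≤ 2 * η := by
          have e2 : t - x (k n) = (t - y) + (y - x₀) - (x (k n) - x₀) := by ring
          rw [e2]
          refine (abs_sub _ _).trans ?_
          linarith [abs_add_le (t - y) (y - x₀)]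
        have e3 : ‖φ (k n) t - φ (k n) (x (k n))‖ ≤ δ / 2 := by
          refine (norm_sub_le_sqrt _ _ _).trans ?_
          calc √|t - x (k n)| * ‖toL2 (D (φ (k n)))‖ ≤ √(2 * η) * √M := by
                gcongr
                exact hD _
            _ = δ / 2 := by
                rw [← Real.sqrt_mul (by positivity), Real.sqrt_eq_iff_mul_self_eq (by positivity)
                  (by positivity), hη]
                field_simp
                norm_num
        linarith [hxδ (k n)]
      have h3 : (((SignType.sign d : ℝ) : ℂ) * θ *
          (((f - BoundedContinuousFunction.const ℝ (ε (k n) * l (k n))) t : ℝ) * φ (k n) t)).re =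
          ((SignType.sign d : ℝ) * (f t - ε (k n) * l (k n))) * (θ * φ (k n) t).re := by
        rw [← Complex.re_ofReal_mul]
        congr 1
        rw [BoundedContinuousFunction.coe_sub, Pi.sub_apply,
          BoundedContinuousFunction.const_apply]
        push_cast
        ring
      rw [h3]
      exact mul_le_mul h1 h2 (by positivity) (le_trans (by positivity) h1)
  have hlim0 : Tendsto (fun n => ε (k n) * (‖toL2 χ‖ * M + ‖toL2 (osc χ)‖)) atTop (𝓝 0) := by
    simpa using (hε0.comp hk.tendsto_atTop).mul_const (‖toL2 χ‖ * M + ‖toL2 (osc χ)‖)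
  have := ge_of_tendsto hlim0 hlow
  have : 0 < (|d| / 2 * (δ / 2)) * ∫ t, b t := by positivity
  linarith

/-- If no level set of `f` has interior, then the lower bound of `H_ε - i l` exceeds any `M`,
uniformly in `l`, once `ε` is small. -/
theorem exists_forall_le_norm_skewSchwartz (f : ℝ →ᵇ ℝ)
    (hf : ∀ c : ℝ, interior {x : ℝ | f x = c} = ∅) {M : ℝ} (hM : 0 < M) :
    ∃ ε₀ > 0, ∀ ε, 0 < ε → ε < ε₀ → ∀ l φ,
      M * ‖toL2 φ‖ ≤ ‖skewSchwartz (shifted f ε l) φ‖ := by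
  by_contra! hcon
  choose ε hε0 hε l φ hφ using fun n : ℕ => hcon (1 / ((n : ℝ) + 1)) (by positivity)
  have hne : ∀ n, ‖toL2 (φ n)‖ ≠ 0 := fun n h0 => by
    have h1 := hφ n
    rw [h0, mul_zero] at h1
    have h2 := norm_nonneg (skewSchwartz (shifted f (ε n) (l n)) (φ n))
    linarith
  refine not_exists_quasimodes f hf hM (ε := ε) (l := l)
    (φ := fun n => ((‖toL2 (φ n)‖⁻¹ : ℝ) : ℂ) • φ n) hε0 ?_ ?_ ?_ ?_
  · exact squeeze_zero (fun n => (hε0 n).le) (fun n => (hε n).le)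
      tendsto_one_div_add_atTop_nhds_zero_nat
  · intro n
    refine (hε n).le.trans ?_
    rw [div_le_one (by positivity)]
    linarith [(Nat.cast_nonneg n : (0 : ℝ) ≤ n)]
  · intro n
    rw [map_smul, norm_smul, Complex.norm_real, norm_inv, norm_norm, inv_mul_cancel₀ (hne n)]
  · intro n
    rw [map_smul, norm_smul, Complex.norm_real, norm_inv, norm_norm,
      inv_mul_le_iff₀ (lt_of_le_of_ne (norm_nonneg _) (hne n).symm)]
    linarith [hφ n]

theorem tendsto_Psi (f : ℝ →ᵇ ℝ) (hf : ∀ c : ℝ, interior {x : ℝ | f x = c} = ∅) :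
    Tendsto (Psi f) (𝓝[>] (0 : ℝ)) (𝓝 ∞) := by
  rw [ENNReal.tendsto_nhds_top_iff_nnreal]
  intro M
  obtain ⟨ε₀, hε₀, h⟩ := exists_forall_le_norm_skewSchwartz f hf
    (M := ((M + 1 : ℝ≥0) : ℝ)) (by positivity)
  filter_upwards [Ioo_mem_nhdsGT hε₀] with ε hε
  have h1 : ((M + 1 : ℝ≥0) : ℝ≥0∞) ≤ Psi f ε :=
    le_Psi f hε.1 (by positivity) fun l u => le_norm_skew (h ε hε.1 hε.2 l) u
  refine lt_of_lt_of_le ?_ h1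
  exact_mod_cast lt_add_one M

end SkewOscillator

end

/-- For bounded continuous `f`: `Ψ(ε)` is well defined with values in `(0, ∞)` (the imaginary axis
lies in the resolvent set of `H_ε`); `Ψ(ε) → ∞` as `ε → 0⁺` if and only if all level sets of `f`
have empty interior; otherwise `Ψ` is bounded uniformly in `ε > 0`. -/
theorem proposition1 (f : ℝ →ᵇ ℝ) :
    (∀ ε : ℝ, 0 < ε →
      (∀ l : ℝ, Complex.I * (l : ℂ) ∈ SkewOscillator.resolventSet (SkewOscillator.H f ε)) ∧
      0 < SkewOscillator.Psi f ε ∧ SkewOscillator.Psi f ε < ∞) ∧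
    (Tendsto (SkewOscillator.Psi f) (𝓝[>] (0 : ℝ)) (𝓝 ∞) ↔
      ∀ c : ℝ, interior {x : ℝ | f x = c} = ∅) ∧
    ((¬ ∀ c : ℝ, interior {x : ℝ | f x = c} = ∅) →
      ∃ C : ℝ≥0, ∀ ε : ℝ, 0 < ε → SkewOscillator.Psi f ε ≤ C) := by
  have hbdd : (¬ ∀ c : ℝ, interior {x : ℝ | f x = c} = ∅) →
      ∃ C : ℝ≥0, ∀ ε : ℝ, 0 < ε → SkewOscillator.Psi f ε ≤ C := by
    intro h
    push Not at h
    obtain ⟨c, hc⟩ := h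
    exact SkewOscillator.exists_Psi_le f hc
  refine ⟨fun ε hε => ⟨fun l => SkewOscillator.exists_isResolventAt f hε l,
    SkewOscillator.Psi_pos f hε, SkewOscillator.Psi_lt_top f hε⟩,
    ⟨fun h => ?_, SkewOscillator.tendsto_Psi f⟩, hbdd⟩
  by_contra hcon
  obtain ⟨C, hC⟩ := hbdd hcon
  refine ENNReal.coe_ne_top (r := C) (top_le_iff.mp (le_of_tendsto h ?_))
  filter_upwards [self_mem_nhdsWithin] with ε hε
  exact hC ε hε
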